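/- **Setting.** On $L^2(\mathbb R)$ let $[Tf](x)=f(x-1)$ and $[Df](x)=\sqrt2\,f(2x)$. Let $\partial\mathbb D=\{\omega\in\mathbb C:|\omega|=1\}$ carry normalized Lebesgue measure. Let $I,J$ be denumerable sets, let $\{L_i\}_{i\in I}$, $\{K_{+,j}\}_{j\in J}$, $\{K_{-,j}\}_{j\in J}$ be orthonormal bases of $L^2[0,1)$, $L^2[1,2)$, $L^2(-2,-1]$ (extended by zero to $\mathbb R$), and let $\{u_i\}_{i\in I}$, $\{u_{s,j}\}_{s=\pm,j\in J}$ be orthonormal bases of $\ell^2(I)$ and $\ell^2(J)\oplus\ell^2(J)$. The spectral models of $T$ and $D$ are the unitary operators $$\mathcal F:L^2(\mathbb R)\to L^2(\partial\mathbb D;\ell^2(I)),\quad \mathcal Ff=\sum_{i\in I,\,n\in\mathbb Z}(f,T^nL_i)\,\omega^n u_i,$$ $$\mathcal G:L^2(\mathbb R)\to L^2(\partial\mathbb D;\ell^2(J)\oplus\ell^2(J)),\quad \mathcal Gf=\sum_{s=\pm,\,j\in J,\,m\in\mathbb Z}(f,D^mK_{s,j})\,\omega^m u_{s,j}.$$ For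 a separable Hilbert space $\mathcal H$, a rigid function on $L^2(\partial\mathbb D;\mathcal H)$ is a weakly measurable $A:\partial\mathbb D\to\mathcal L(\mathcal H)$ such that, for a.e. $\omega$, $A(\omega)$ is a partial isometry with initial space a fixed closed subspace of $\mathcal H$, called the initial space of $A$; for $X\subseteq L^2(\partial\mathbb D;\mathcal H)$ put $AX=\{A(\cdot)\mathbf v(\cdot):\mathbf v\in X\}$. Let $\hat{\mathfrak C}$ be the space of constant functions in $L^2(\partial\mathbb D;\ell^2(I))$; let $H^+$ be the space of functions $\sum_{k\ge0}\omega^ka_k$ in $L^2(\partial\mathbb D;\ell^2(J)\oplus\ell^2(J))$ with $\sum_k\|a_k\|^2<\infty$, and $H^-$ its orthogonal complement; $\langle\cdot\rangle$ denotes closed linear span. A multiresolution analysis (MRA) is a sequence $\{\mathcal V_n\}_{n\in\mathbb Z}$ of closed subspaces of $L^2(\mathbb R)$ with $\mathcal V_n\subseteq\mathcal V_{n+1}$, $\bigcap_n\mathcal V_n=\{0\}$, $\overline{\bigcup_n\mathcal V_n}=L^2(\mathbb R)$, $f\in\mathcal V_0\Leftrightarrow D^nf\in\mathcal V_n$ for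 all $n$ and $f$, and having a scaling function, i.e. a $\varphi\in L^2(\mathbb R)$ such that $\{T^k\varphi:k\in\mathbb Z\}$ is an orthonormal basis of $\mathcal V_0$. **Theorem.** (1) Let $\varphi$ be a scaling function of an MRA $\{\mathcal V_n\}$. Then there are rigid functions $\hat R$ on $L^2(\partial\mathbb D;\ell^2(I))$ and $\tilde S$ on $L^2(\partial\mathbb D;\ell^2(J)\oplus\ell^2(J))$ such that (i) the initial space of $\hat R$ is one-dimensional and $\tilde S(\omega)$ is unitary for a.e. $\omega$; (ii) $\mathcal V_0=\mathcal F^{-1}\langle\omega^k\hat R\hat{\mathfrak C}:k\in\mathbb Z\rangle=\mathcal G^{-1}\langle\tilde SH^-\rangle$; (iii) $\langle\varphi\rangle=\mathcal F^{-1}\langle\hat R\hat{\mathfrak C}\rangle$. They are unique up to constant partially isometric factors on the right: if $(\hat R,\tilde S)$ and $(\hat R',\tilde S')$ both satisfy (i)–(iii), there are constant partial isometries $U,W$ with $\hat R'(\omega)=\hat R(\omega)U$ and $\tilde S'(\omega)=\tilde S(\omega)W$ a.e., $U$ (resp. $W$) mapping the initial space of $\hat R'$ (resp. $\tilde S'$)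 isometrically onto that of $\hat R$ (resp. $\tilde S$) and vanishing on its orthogonal complement. (2) Conversely, let $(\hat R,\tilde S)$ be rigid functions satisfying (i) and (ii') $\mathcal F^{-1}\langle\omega^k\hat R\hat{\mathfrak C}:k\in\mathbb Z\rangle=\mathcal G^{-1}\langle\tilde SH^-\rangle$. Then for each unit vector $w$ in the initial space of $\hat R$ the function $\varphi:=\mathcal F^{-1}[\hat R(\cdot)w]$ is a scaling function of an MRA $\{\mathcal V_n\}$, and (ii) and (iii) hold. It is unique up to the choice of $w$: every scaling function $\varphi'$ of an MRA $\{\mathcal V'_n\}$ with $\langle\varphi'\rangle=\mathcal F^{-1}\langle\hat R\hat{\mathfrak C}\rangle$ satisfies $\mathcal V'_n=\mathcal V_n$ for all $n$ and $\varphi'=c\varphi$ with a constant $|c|=1$. (3) Whenever $\varphi$ is a scaling function of an MRA $\{\mathcal V_n\}$ and rigid functions $\hat R,\tilde S$ satisfy (i)–(iii), there is a function $\hat K$ from $\partial\mathbb D$ to the closed subspaces of $\ell^2(I)$, with weakly measurable orthogonal projections and $\dim\hat K(\omega)=1$ for a.e. $\omega$, such that, with $\mathfrak M_{\hat K}=\{\mathbf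 f\in L^2(\partial\mathbb D;\ell^2(I)):\mathbf f(\omega)\in\hat K(\omega)\text{ a.e.}\}$, $$\mathcal F^{-1}\mathfrak M_{\hat K}=\mathcal F^{-1}\langle\omega^k\hat R\hat{\mathfrak C}:k\in\mathbb Z\rangle=\mathcal V_0 .$$ -/

import Mathlib

namespace SpectralMRA

open MeasureTheory Set
open scoped ENNReal

noncomputable section

/-- The Hilbert space `L²(ℝ)`. -/
abbrev L2R : Type := Lp ℂ 2 (volume : Measure ℝ)

/-- The Hilbert space `L²(s)` for a set `s ⊆ ℝ`. -/
abbrev L2On (s : Set ℝ) : Type := Lp ℂ 2 ((volume : Measure ℝ).restrict s)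

/-- The unit circle `{ω : |ω| = 1}`, parametrised by `t ∈ ℝ/ℤ` through `ω = e^{2πit}`.
The function `t ↦ ω^n` is `fourier n`. -/
abbrev Circ : Type := UnitAddCircle

/-- Normalised Lebesgue measure on the circle. -/
abbrev circMeasure : Measure Circ := AddCircle.haarAddCircle

/-- The Hilbert space `L²(∂𝔻; H)`. -/
abbrev L2C (H : Type*) [NormedAddCommGroup H] : Type _ := Lp H 2 circMeasure

/-- The Hilbert space `ℓ²(I)`. -/
abbrev Ell2 (I : Type*) : Type _ := lp (fun _ : I => ℂ) 2

/-- The orthogonal sum `ℓ²(J) ⊕ ℓ²(J)`. -/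
abbrev Ell2Sum (J : Type*) : Type _ := WithLp 2 (Ell2 J × Ell2 J)

theorem map_affine (a b : ℝ) (ha : 0 < a) :
    Measure.map (fun x : ℝ => a * x + b) volume = ENNReal.ofReal a⁻¹ • (volume : Measure ℝ) := by
  have h1 : (fun x : ℝ => a * x + b) = (fun x => x + b) ∘ (fun x => a * x) := rfl
  rw [h1, ← Measure.map_map (by fun_prop) (by fun_prop), Real.map_volume_mul_left ha.ne',
    Measure.map_smul, (measurePreserving_add_right volume b).map_eq,
    abs_of_pos (inv_pos.2 ha)]

theorem qmp_affine (a b : ℝ) (ha : 0 < a) :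
    Measure.QuasiMeasurePreserving (fun x : ℝ => a * x + b) volume volume := by
  refine ⟨by fun_prop, ?_⟩
  rw [map_affine a b ha]
  exact Measure.smul_absolutelyContinuous

theorem eLpNorm_affine (a b : ℝ) (ha : 0 < a) {f : ℝ → ℂ} (hf : AEStronglyMeasurable f volume) :
    eLpNorm (fun x => ((Real.sqrt a : ℝ) : ℂ) • f (a * x + b)) 2 volume = eLpNorm f 2 volume := by
  have h0 : AEStronglyMeasurable f (Measure.map (fun x : ℝ => a * x + b) volume) :=
    hf.mono_ac (qmp_affine a b ha).absolutelyContinuous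
  have h1 : eLpNorm (fun x => f (a * x + b)) 2 volume
      = ENNReal.ofReal a⁻¹ ^ (1 / 2 : ℝ) * eLpNorm f 2 volume := by
    have := eLpNorm_map_measure (p := 2) h0 (by fun_prop)
    rw [map_affine a b ha, eLpNorm_smul_measure_of_ne_top (by simp)] at this
    rw [Function.comp_def] at this
    rw [← this]
    simp
  have h2 : (fun x => ((Real.sqrt a : ℝ) : ℂ) • f (a * x + b))
      = ((Real.sqrt a : ℝ) : ℂ) • (fun x => f (a * x + b)) := rfl
  rw [h2, eLpNorm_const_smul, h1, ← mul_assoc]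
  have h3 : ‖((Real.sqrt a : ℝ) : ℂ)‖ₑ = ENNReal.ofReal a ^ (1 / 2 : ℝ) := by
    rw [ENNReal.ofReal_rpow_of_pos ha, ← Real.sqrt_eq_rpow, ← ofReal_norm]
    simp [abs_of_nonneg (Real.sqrt_nonneg a)]
  rw [h3, ← ENNReal.mul_rpow_of_nonneg _ _ (by norm_num), ← ENNReal.ofReal_mul ha.le,
    mul_inv_cancel₀ ha.ne']
  simp

theorem memLp_affine (a b : ℝ) (ha : 0 < a) (f : L2R) :
    MemLp (fun x => ((Real.sqrt a : ℝ) : ℂ) • f (a * x + b)) 2 volume := by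
  refine ⟨?_, ?_⟩
  · exact ((Lp.aestronglyMeasurable f).comp_quasiMeasurePreserving
      (qmp_affine a b ha)).const_smul ((Real.sqrt a : ℝ) : ℂ)
  · rw [eLpNorm_affine a b ha (Lp.aestronglyMeasurable f)]
    exact Lp.eLpNorm_lt_top f

/-- The map `f ↦ √a · f(a x + b)` on `L²(ℝ)`. -/
def affineFun (a b : ℝ) (ha : 0 < a) (f : L2R) : L2R := (memLp_affine a b ha f).toLp

theorem affineFun_ae (a b : ℝ) (ha : 0 < a) (f : L2R) :
    affineFun a b ha f =ᵐ[volume] fun x => ((Real.sqrt a : ℝ) : ℂ) • f (a * x + b) :=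
  MemLp.coeFn_toLp _

theorem affineFun_comp (a b c d e k : ℝ) (ha : 0 < a) (hc : 0 < c) (he : 0 < e)
    (h1 : e = a * c) (h2 : k = c * b + d) (f : L2R) :
    affineFun a b ha (affineFun c d hc f) = affineFun e k he f := by
  apply Lp.ext
  filter_upwards [affineFun_ae a b ha (affineFun c d hc f), affineFun_ae e k he f,
    (qmp_affine a b ha).ae (affineFun_ae c d hc f)] with x h3 h4 h5
  rw [h3, h4, h5, smul_smul, ← Complex.ofReal_mul, ← Real.sqrt_mul ha.le, h1, h2]
  congr 2
  ring

theorem affineFun_one (f : L2R) : affineFun 1 0 one_pos f = f := by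
  apply Lp.ext
  filter_upwards [affineFun_ae 1 0 one_pos f] with x hx
  simpa using hx

/-- The unitary operator `f ↦ √a · f(a x + b)` on `L²(ℝ)`. -/
def affineOp (a b : ℝ) (ha : 0 < a) : L2R ≃ₗᵢ[ℂ] L2R where
  toFun := affineFun a b ha
  invFun := affineFun a⁻¹ (-(a⁻¹ * b)) (inv_pos.2 ha)
  map_add' f g := by
    apply Lp.ext
    filter_upwards [affineFun_ae a b ha (f + g), affineFun_ae a b ha f, affineFun_ae a b ha g,
      (qmp_affine a b ha).ae (Lp.coeFn_add f g),
      Lp.coeFn_add (affineFun a b ha f) (affineFun a b ha g)] with x h1 h2 h3 h4 h5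
    rw [h1, h5, Pi.add_apply, h2, h3, h4, Pi.add_apply, smul_add]
  map_smul' c f := by
    apply Lp.ext
    filter_upwards [affineFun_ae a b ha (c • f), affineFun_ae a b ha f,
      (qmp_affine a b ha).ae (Lp.coeFn_smul c f),
      Lp.coeFn_smul c (affineFun a b ha f)] with x h1 h2 h4 h5
    rw [RingHom.id_apply, h1, h5, Pi.smul_apply, h2, h4, Pi.smul_apply, smul_comm]
  left_inv f := by
    rw [affineFun_comp a⁻¹ (-(a⁻¹ * b)) a b 1 0 (inv_pos.2 ha) ha one_pos
      (inv_mul_cancel₀ ha.ne').symm (by field_simp; ring), affineFun_one]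
  right_inv f := by
    rw [affineFun_comp a b a⁻¹ (-(a⁻¹ * b)) 1 0 ha (inv_pos.2 ha) one_pos
      (mul_inv_cancel₀ ha.ne').symm (by ring), affineFun_one]
  norm_map' f := by
    change ‖affineFun a b ha f‖ = ‖f‖
    rw [Lp.norm_def, Lp.norm_def, eLpNorm_congr_ae (affineFun_ae a b ha f),
      eLpNorm_affine a b ha (Lp.aestronglyMeasurable f)]

theorem affineOp_ae (a b : ℝ) (ha : 0 < a) (f : L2R) :
    affineOp a b ha f =ᵐ[volume] fun x => ((Real.sqrt a : ℝ) : ℂ) • f (a * x + b) :=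
  affineFun_ae a b ha f

theorem affineOp_mul (a b c d e k : ℝ) (ha : 0 < a) (hc : 0 < c) (he : 0 < e)
    (h1 : e = a * c) (h2 : k = c * b + d) :
    affineOp a b ha * affineOp c d hc = affineOp e k he :=
  LinearIsometryEquiv.ext fun f => affineFun_comp a b c d e k ha hc he h1 h2 f

theorem affineOp_one : affineOp 1 0 one_pos = 1 :=
  LinearIsometryEquiv.ext affineFun_one

/-- The translation operator `(T f)(x) = f(x - 1)`. -/
def T : L2R ≃ₗᵢ[ℂ] L2R := affineOp 1 (-1) one_pos

/-- The dyadic dilation operator `(D f)(x) = √2 f(2x)`. -/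
def D : L2R ≃ₗᵢ[ℂ] L2R := affineOp 2 0 two_pos

theorem T_zpow (n : ℤ) : T ^ n = affineOp 1 (-n) one_pos := by
  induction n using Int.induction_on with
  | zero => simp [affineOp_one]
  | succ n ih =>
    rw [zpow_add_one, ih, T]
    exact affineOp_mul _ _ _ _ _ _ _ _ _ (by norm_num) (by push_cast; ring)
  | pred n ih =>
    rw [zpow_sub_one, ih, mul_inv_eq_iff_eq_mul, T]
    exact (affineOp_mul _ _ _ _ _ _ _ _ _ (by norm_num) (by push_cast; ring)).symm

theorem D_zpow (n : ℤ) : D ^ n = affineOp ((2 : ℝ) ^ n) 0 (zpow_pos two_pos n) := by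
  induction n using Int.induction_on with
  | zero => simp [affineOp_one]
  | succ n ih =>
    rw [zpow_add_one, ih, D]
    exact affineOp_mul _ _ _ _ _ _ _ _ _ (by rw [zpow_add_one₀ two_ne_zero]) (by ring)
  | pred n ih =>
    rw [zpow_sub_one, ih, mul_inv_eq_iff_eq_mul, D]
    exact (affineOp_mul _ _ _ _ _ _ _ _ _
      (by rw [zpow_sub_one₀ two_ne_zero]; ring) (by ring)).symm

theorem memLp_extZero (s : Set ℝ) (hs : MeasurableSet s)
    (f : L2On s) :
    MemLp (s.indicator f) 2 (volume : Measure ℝ) :=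
  (memLp_indicator_iff_restrict hs).2 (Lp.memLp f)

/-- Extension by zero, as an isometry `L²(s) → L²(ℝ)`. -/
def extZero (s : Set ℝ) (hs : MeasurableSet s) :
    L2On s →ₗᵢ[ℂ] L2R where
  toFun f := (memLp_extZero s hs f).toLp
  map_add' f g := by
    rw [← MemLp.toLp_add]
    apply MemLp.toLp_congr
    have := (ae_restrict_iff' hs).1 (Lp.coeFn_add f g)
    filter_upwards [this] with x hx
    by_cases h : x ∈ s
    · rw [Pi.add_apply, indicator_of_mem h, indicator_of_mem h, indicator_of_mem h, hx h,
        Pi.add_apply]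
    · simp [h]
  map_smul' c f := by
    rw [RingHom.id_apply, ← MemLp.toLp_const_smul]
    apply MemLp.toLp_congr
    have := (ae_restrict_iff' hs).1 (Lp.coeFn_smul c f)
    filter_upwards [this] with x hx
    by_cases h : x ∈ s
    · rw [Pi.smul_apply, indicator_of_mem h, indicator_of_mem h, hx h, Pi.smul_apply]
    · simp [h]
  norm_map' f := by
    change ‖(memLp_extZero s hs f).toLp‖ = _
    rw [Lp.norm_toLp, Lp.norm_def, eLpNorm_indicator_eq_eLpNorm_restrict hs]

theorem extZero_ae (s : Set ℝ) (hs : MeasurableSet s)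
    (f : L2On s) :
    extZero s hs f =ᵐ[volume] s.indicator f :=
  MemLp.coeFn_toLp (memLp_extZero s hs f)

theorem inner_eq_zero_of_disjoint {f g : L2R} {A B : Set ℝ} (hAB : Disjoint A B)
    (hf : ∀ᵐ x, x ∉ A → f x = 0) (hg : ∀ᵐ x, x ∉ B → g x = 0) : inner ℂ f g = 0 := by
  rw [L2.inner_def]
  apply integral_eq_zero_of_ae
  filter_upwards [hf, hg] with x h1 h2
  by_cases h : x ∈ A
  · simp [h2 (disjoint_left.1 hAB h)]
  · simp [h1 h]

theorem extZero_off (s : Set ℝ) (hs : MeasurableSet s)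
    (f : L2On s) : ∀ᵐ x, x ∉ s → extZero s hs f x = 0 := by
  filter_upwards [extZero_ae s hs f] with x h1 h2
  rw [h1, indicator_of_notMem h2]

theorem affine_off {a b : ℝ} (ha : 0 < a) {s : Set ℝ} {f : L2R} (hf : ∀ᵐ x, x ∉ s → f x = 0) :
    ∀ᵐ x, x ∉ {x | a * x + b ∈ s} → affineOp a b ha f x = 0 := by
  filter_upwards [affineOp_ae a b ha f, (qmp_affine a b ha).ae hf] with x h1 h2 h3
  rw [h1, h2 h3, smul_zero]

theorem eq_zero_of_inner {ι : Type*} {E : Type*} [NormedAddCommGroup E] [InnerProductSpace ℂ E]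
    (b : HilbertBasis ι ℂ E) {v : E} (h : ∀ i, inner ℂ (b i) v = 0) : v = 0 := by
  apply b.repr.injective
  ext i
  rw [b.repr_apply_apply, h, map_zero]
  rfl

theorem ae_zero_of_inner_extZero {ι : Type*} (s : Set ℝ) (hs : MeasurableSet s)
    (b : HilbertBasis ι ℂ (L2On s)) {f : L2R}
    (h : ∀ i, inner ℂ (extZero s hs (b i)) f = 0) : ∀ᵐ x, x ∈ s → f x = 0 := by
  have hm : MemLp f 2 ((volume : Measure ℝ).restrict s) := (Lp.memLp f).restrict s
  have h1 : hm.toLp = 0 := by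
    refine eq_zero_of_inner b fun i => ?_
    rw [← h i, L2.inner_def, L2.inner_def, ← integral_indicator hs]
    apply integral_congr_ae
    filter_upwards [extZero_ae s hs (b i), (ae_restrict_iff' hs).1 hm.coeFn_toLp] with x h1 h2
    by_cases hx : x ∈ s
    · rw [indicator_of_mem hx, h1, indicator_of_mem hx, h2 hx]
    · rw [indicator_of_notMem hx, h1, indicator_of_notMem hx, inner_zero_left]
  rw [← ae_restrict_iff' hs]
  have h2 := hm.coeFn_toLp
  rw [h1] at h2
  filter_upwards [h2, Lp.coeFn_zero ℂ 2 ((volume : Measure ℝ).restrict s)] with x h3 h4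
  rw [← h3, h4, Pi.zero_apply]

theorem inner_zpow {E : Type*} [NormedAddCommGroup E] [InnerProductSpace ℂ E]
    (U : E ≃ₗᵢ[ℂ] E) (n m : ℤ) (f g : E) :
    inner ℂ ((U ^ n) f) ((U ^ m) g) = inner ℂ ((U ^ (n - m)) f) g := by
  rw [← (U ^ m).inner_map_map ((U ^ (n - m)) f) g]
  congr 1
  change _ = ((U ^ m) * (U ^ (n - m))) f
  rw [← zpow_add]
  congr 2
  ring

theorem orthonormal_zpow {ι E : Type*} [NormedAddCommGroup E] [InnerProductSpace ℂ E]
    (U : E ≃ₗᵢ[ℂ] E) (e : ι → E) (he : Orthonormal ℂ e)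
    (h : ∀ n : ℤ, n ≠ 0 → ∀ i j, inner ℂ ((U ^ n) (e i)) (e j) = 0) :
    Orthonormal ℂ (fun p : ι × ℤ => (U ^ p.2) (e p.1)) := by
  refine ⟨fun p => ?_, fun p q hpq => ?_⟩
  · rw [LinearIsometryEquiv.norm_map, he.1]
  · change inner ℂ ((U ^ p.2) (e p.1)) ((U ^ q.2) (e q.1)) = 0
    rw [inner_zpow]
    by_cases hn : p.2 - q.2 = 0
    · rw [hn, zpow_zero]
      refine he.2 fun h1 => hpq (Prod.ext h1 (sub_eq_zero.1 hn))
    · exact h _ hn _ _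

theorem inner_zpow_neg {E : Type*} [NormedAddCommGroup E] [InnerProductSpace ℂ E]
    (U : E ≃ₗᵢ[ℂ] E) (n : ℤ) (f g : E) :
    inner ℂ ((U ^ n) f) g = inner ℂ f ((U ^ (-n)) g) := by
  have := inner_zpow U 0 (-n) f g
  rw [zpow_zero, zero_sub, neg_neg] at this
  exact this.symm

/-- `L_i^{(n)}(x) = L_i^{(0)}(x - n)`. -/
def Lfam {I : Type*} (L : HilbertBasis I ℂ (L2On (Ico 0 1)))
    (p : I × ℤ) : L2R :=
  (T ^ p.2) (extZero (Ico 0 1) measurableSet_Ico (L p.1))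

theorem Lfam_orthonormal {I : Type*}
    (L : HilbertBasis I ℂ (L2On (Ico 0 1))) :
    Orthonormal ℂ (Lfam L) := by
  refine orthonormal_zpow T (fun i => extZero (Ico 0 1) measurableSet_Ico (L i))
    (L.orthonormal.comp_linearIsometry _) fun n hn i j => ?_
  rw [T_zpow]
  refine inner_eq_zero_of_disjoint ?_ (affine_off _ (extZero_off _ _ _)) (extZero_off _ _ _)
  rw [disjoint_left]
  rintro x ⟨h1, h2⟩ ⟨h3, h4⟩
  have h5 : -1 < n := by exact_mod_cast (by push_cast; linarith : ((-1 : ℤ) : ℝ) < n)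
  have h6 : n < 1 := by exact_mod_cast (by push_cast; linarith : (n : ℝ) < (1 : ℤ))
  omega

theorem Lfam_complete {I : Type*}
    (L : HilbertBasis I ℂ (L2On (Ico 0 1))) :
    (Submodule.span ℂ (range (Lfam L)))ᗮ = ⊥ := by
  rw [Submodule.eq_bot_iff]
  intro f hf
  have h1 : ∀ n : ℤ, ∀ᵐ x, x ∈ Ico (0 : ℝ) 1 → ((T ^ (-n)) f) x = 0 := fun n =>
    ae_zero_of_inner_extZero (Ico 0 1) measurableSet_Ico L fun i => by
      rw [← inner_zpow_neg]
      exact hf _ (Submodule.subset_span ⟨(i, n), rfl⟩)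
  have h2 : ∀ n : ℤ, ∀ᵐ x : ℝ, x - n ∈ Ico (0 : ℝ) 1 → f x = 0 := fun n => by
    have h3 := h1 n
    rw [T_zpow] at h3
    filter_upwards [(qmp_affine 1 (-n) one_pos).ae h3,
      (qmp_affine 1 (-n) one_pos).ae (affineOp_ae 1 (-((-n : ℤ) : ℝ)) one_pos f)] with x h4 h5 h6
    rw [h5] at h4
    have := h4 (by simpa [sub_eq_add_neg] using h6)
    simpa using this
  apply Lp.ext
  filter_upwards [ae_all_iff.2 h2, Lp.coeFn_zero ℂ 2 (volume : Measure ℝ)] with x h3 h4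
  rw [h4, Pi.zero_apply]
  exact h3 ⌊x⌋ ⟨sub_nonneg.2 (Int.floor_le x), by linarith [Int.lt_floor_add_one x]⟩

/-- The orthonormal basis `{L_i^{(n)}}` of `L²(ℝ)`. -/
def Lbasis {I : Type*} (L : HilbertBasis I ℂ (L2On (Ico 0 1))) :
    HilbertBasis (I × ℤ) ℂ L2R :=
  HilbertBasis.mkOfOrthogonalEqBot (Lfam_orthonormal L) (Lfam_complete L)

/-- `K_{s,j}^{(0)}` extended by zero. -/
def Kzero {J : Type*}
    (Kp : HilbertBasis J ℂ (L2On (Ico 1 2)))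
    (Km : HilbertBasis J ℂ (L2On (Ioc (-2) (-1)))) :
    J ⊕ J → L2R :=
  Sum.elim (fun j => extZero (Ico 1 2) measurableSet_Ico (Kp j))
    (fun j => extZero (Ioc (-2) (-1)) measurableSet_Ioc (Km j))

/-- `K_{s,j}^{(m)}(x) = 2^{m/2} K_{s,j}^{(0)}(2^m x)`. -/
def Kfam {J : Type*}
    (Kp : HilbertBasis J ℂ (L2On (Ico 1 2)))
    (Km : HilbertBasis J ℂ (L2On (Ioc (-2) (-1))))
    (p : (J ⊕ J) × ℤ) : L2R :=
  (D ^ p.2) (Kzero Kp Km p.1)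

theorem Kzero_off {J : Type*}
    (Kp : HilbertBasis J ℂ (L2On (Ico 1 2)))
    (Km : HilbertBasis J ℂ (L2On (Ioc (-2) (-1))))
    (i : J ⊕ J) : ∀ᵐ x : ℝ, x ∉ {x : ℝ | 1 ≤ |x| ∧ |x| < 2} → Kzero Kp Km i x = 0 := by
  rcases i with j | j
  · filter_upwards [extZero_off _ measurableSet_Ico (Kp j)] with x h1 h2
    refine h1 fun h3 => h2 ?_
    have : |x| = x := abs_of_pos (by linarith [h3.1])
    rw [this]
    exact h3
  · filter_upwards [extZero_off _ measurableSet_Ioc (Km j)] with x h1 h2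
    refine h1 fun h3 => h2 ?_
    have : |x| = -x := abs_of_neg (by linarith [h3.2])
    rw [this]
    exact ⟨by linarith [h3.2], by linarith [h3.1]⟩

theorem Kzero_orthonormal {J : Type*}
    (Kp : HilbertBasis J ℂ (L2On (Ico 1 2)))
    (Km : HilbertBasis J ℂ (L2On (Ioc (-2) (-1)))) :
    Orthonormal ℂ (Kzero Kp Km) := by
  have hp := Kp.orthonormal.comp_linearIsometry (extZero (Ico 1 2) measurableSet_Ico)
  have hm := Km.orthonormal.comp_linearIsometry (extZero (Ioc (-2) (-1)) measurableSet_Ioc)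
  have hd : Disjoint (Ico (1 : ℝ) 2) (Ioc (-2) (-1)) := by
    rw [disjoint_left]
    rintro x ⟨h1, h2⟩ ⟨h3, h4⟩
    linarith
  refine ⟨?_, ?_⟩
  · rintro (j | j)
    · exact hp.1 j
    · exact hm.1 j
  · rintro (i | i) (j | j) hij
    · exact hp.2 fun h => hij (congrArg _ h)
    · exact inner_eq_zero_of_disjoint hd (extZero_off _ _ _) (extZero_off _ _ _)
    · exact inner_eq_zero_of_disjoint hd.symm (extZero_off _ _ _) (extZero_off _ _ _)
    · exact hm.2 fun h => hij (congrArg _ h)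

theorem Kfam_orthonormal {J : Type*}
    (Kp : HilbertBasis J ℂ (L2On (Ico 1 2)))
    (Km : HilbertBasis J ℂ (L2On (Ioc (-2) (-1)))) :
    Orthonormal ℂ (Kfam Kp Km) := by
  refine orthonormal_zpow D (Kzero Kp Km) (Kzero_orthonormal Kp Km) fun n hn i j => ?_
  rw [D_zpow]
  refine inner_eq_zero_of_disjoint ?_ (affine_off _ (Kzero_off Kp Km i)) (Kzero_off Kp Km j)
  rw [disjoint_left]
  rintro x ⟨h1, h2⟩ ⟨h3, h4⟩
  have hpos : (0 : ℝ) < 2 ^ n := zpow_pos two_pos n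
  rw [add_zero, abs_mul, abs_of_pos hpos] at h1 h2
  rcases lt_or_gt_of_ne hn with h | h
  · have : (2 : ℝ) ^ n ≤ 2 ^ (-1 : ℤ) := zpow_le_zpow_right₀ one_le_two (by omega)
    norm_num at this
    nlinarith
  · have : (2 : ℝ) ^ (1 : ℤ) ≤ 2 ^ n := zpow_le_zpow_right₀ one_le_two (by omega)
    norm_num at this
    nlinarith

theorem Kfam_complete {J : Type*}
    (Kp : HilbertBasis J ℂ (L2On (Ico 1 2)))
    (Km : HilbertBasis J ℂ (L2On (Ioc (-2) (-1)))) :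
    (Submodule.span ℂ (range (Kfam Kp Km)))ᗮ = ⊥ := by
  rw [Submodule.eq_bot_iff]
  intro f hf
  have h1 : ∀ n : ℤ, ∀ᵐ x : ℝ, 1 ≤ |x| ∧ |x| < 2 → ((D ^ (-n)) f) x = 0 := fun n => by
    have hp : ∀ᵐ x, x ∈ Ico (1 : ℝ) 2 → ((D ^ (-n)) f) x = 0 :=
      ae_zero_of_inner_extZero (Ico 1 2) measurableSet_Ico Kp fun i => by
        rw [← inner_zpow_neg]
        exact hf _ (Submodule.subset_span ⟨(Sum.inl i, n), rfl⟩)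
    have hm : ∀ᵐ x, x ∈ Ioc (-2 : ℝ) (-1) → ((D ^ (-n)) f) x = 0 :=
      ae_zero_of_inner_extZero (Ioc (-2) (-1)) measurableSet_Ioc Km fun i => by
        rw [← inner_zpow_neg]
        exact hf _ (Submodule.subset_span ⟨(Sum.inr i, n), rfl⟩)
    filter_upwards [hp, hm] with x h2 h3 ⟨h4, h5⟩
    rcases le_total 0 x with h | h
    · rw [abs_of_nonneg h] at h4 h5
      exact h2 ⟨h4, h5⟩
    · rw [abs_of_nonpos h] at h4 h5
      exact h3 ⟨by linarith, by linarith⟩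
  have h2 : ∀ n : ℤ, ∀ᵐ x : ℝ, 1 ≤ |2 ^ n * x| ∧ |2 ^ n * x| < 2 → f x = 0 := fun n => by
    have h3 := h1 n
    rw [D_zpow] at h3
    filter_upwards [(qmp_affine (2 ^ n) 0 (zpow_pos two_pos n)).ae h3,
      (qmp_affine (2 ^ n) 0 (zpow_pos two_pos n)).ae
        (affineOp_ae (2 ^ (-n)) 0 (zpow_pos two_pos (-n)) f)] with x h4 h5 h6
    rw [h5] at h4
    have h7 := h4 (by simpa using h6)
    have h8 : (2 : ℝ) ^ (-n) * (2 ^ n * x + 0) + 0 = x := by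
      rw [add_zero, add_zero, ← mul_assoc, ← zpow_add₀ two_ne_zero]
      simp
    rw [h8, smul_eq_zero] at h7
    refine h7.resolve_left ?_
    exact Complex.ofReal_ne_zero.2 (Real.sqrt_pos.2 (zpow_pos two_pos _)).ne'
  apply Lp.ext
  have h0 : ∀ᵐ x : ℝ, x ≠ 0 := by
    rw [ae_iff]
    simp
  filter_upwards [ae_all_iff.2 h2, Lp.coeFn_zero ℂ 2 (volume : Measure ℝ), h0] with x h3 h4 h5
  rw [h4, Pi.zero_apply]
  obtain ⟨n, h6, h7⟩ := exists_mem_Ico_zpow (abs_pos.2 h5) (one_lt_two : (1 : ℝ) < 2)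
  have hpos : (0 : ℝ) < 2 ^ (-n) := zpow_pos two_pos _
  have hone : (2 : ℝ) ^ (-n) * 2 ^ n = 1 := by
    rw [← zpow_add₀ two_ne_zero]
    simp
  refine h3 (-n) ?_
  rw [abs_mul, abs_of_pos hpos]
  rw [zpow_add_one₀ two_ne_zero] at h7
  constructor
  · rw [← hone]
    exact mul_le_mul_of_nonneg_left h6 hpos.le
  · calc (2 : ℝ) ^ (-n) * |x| < 2 ^ (-n) * (2 ^ n * 2) := mul_lt_mul_of_pos_left h7 hpos
      _ = 2 := by rw [← mul_assoc, hone, one_mul]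

/-- The orthonormal basis `{K_{s,j}^{(m)}}` of `L²(ℝ)`. -/
def Kbasis {J : Type*}
    (Kp : HilbertBasis J ℂ (L2On (Ico 1 2)))
    (Km : HilbertBasis J ℂ (L2On (Ioc (-2) (-1)))) :
    HilbertBasis ((J ⊕ J) × ℤ) ℂ L2R :=
  HilbertBasis.mkOfOrthogonalEqBot (Kfam_orthonormal Kp Km) (Kfam_complete Kp Km)

section Circle

variable {H : Type*} [NormedAddCommGroup H] [InnerProductSpace ℂ H]

/-- The element `ω ↦ ω^n h` of `L²(∂𝔻; H)`. -/
def monomial (n : ℤ) (h : H) : L2C H :=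
  ContinuousMap.toLp 2 circMeasure ℂ ⟨fun t : Circ => fourier n t • h, by fun_prop⟩

theorem monomial_ae (n : ℤ) (h : H) :
    monomial n h =ᵐ[circMeasure] fun t => fourier n t • h :=
  ContinuousMap.coeFn_toLp circMeasure _

theorem monomial_add (n : ℤ) (h g : H) : monomial n (h + g) = monomial n h + monomial n g := by
  rw [monomial, monomial, monomial, ← map_add]
  congr 1
  ext t
  simp

theorem monomial_smul (n : ℤ) (c : ℂ) (h : H) : monomial n (c • h) = c • monomial n h := by
  rw [monomial, monomial, ← map_smul]
  congr 1
  ext t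
  simp [smul_comm c]

theorem inner_monomial (n : ℤ) (h : H) (f : L2C H) (hf : MemLp (fun t => inner ℂ h (f t)) 2
    circMeasure) : inner ℂ (monomial n h) f = fourierBasis.repr hf.toLp n := by
  rw [fourierBasis_repr, L2.inner_def, fourierCoeff]
  apply integral_congr_ae
  filter_upwards [monomial_ae n h, hf.coeFn_toLp] with t h1 h2
  rw [h1, h2, inner_smul_left, fourier_neg, smul_eq_mul]

theorem inner_monomial_monomial (n m : ℤ) (h g : H) :
    inner ℂ (monomial n h) (monomial m g) = if n = m then inner ℂ h g else 0 := by
  have h1 : inner ℂ (monomial n h) (monomial m g)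
      = inner ℂ (fourierLp 2 n : Lp ℂ 2 circMeasure) (fourierLp 2 m) * inner ℂ h g := by
    rw [L2.inner_def, L2.inner_def, ← integral_mul_const]
    apply integral_congr_ae
    filter_upwards [monomial_ae n h, monomial_ae m g, coeFn_fourierLp (T := 1) 2 n,
      coeFn_fourierLp (T := 1) 2 m] with t h1 h2 h3 h4
    rw [h1, h2, h3, h4, inner_smul_left, inner_smul_right, RCLike.inner_apply]
    ring
  rw [h1, (orthonormal_iff_ite.1 orthonormal_fourier) n m]
  split_ifs <;> simp

theorem monomial_orthonormal {ι : Type*} (u : HilbertBasis ι ℂ H) :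
    Orthonormal ℂ (fun p : ι × ℤ => monomial p.2 (u p.1)) := by
  classical
  rw [orthonormal_iff_ite]
  rintro ⟨i, n⟩ ⟨j, m⟩
  rw [inner_monomial_monomial, (orthonormal_iff_ite.1 u.orthonormal) i j]
  simp only [Prod.mk.injEq]
  split_ifs <;> simp_all

theorem monomial_complete {ι : Type*} [Countable ι] (u : HilbertBasis ι ℂ H) :
    (Submodule.span ℂ (range fun p : ι × ℤ => monomial p.2 (u p.1)))ᗮ = ⊥ := by
  rw [Submodule.eq_bot_iff]
  intro f hf
  have h1 : ∀ i : ι, ∀ᵐ t ∂circMeasure, inner ℂ (u i) (f t) = 0 := fun i => by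
    have hm : MemLp (fun t => inner ℂ (u i) (f t)) 2 circMeasure := (Lp.memLp f).const_inner (u i)
    have h2 : hm.toLp = 0 := by
      apply (fourierBasis (T := 1)).repr.injective
      ext n
      rw [← inner_monomial n (u i) f hm, map_zero]
      exact hf _ (Submodule.subset_span ⟨(i, n), rfl⟩)
    have h3 := hm.coeFn_toLp
    rw [h2] at h3
    filter_upwards [h3, Lp.coeFn_zero ℂ 2 circMeasure] with t h4 h5
    rw [← h4, h5, Pi.zero_apply]
  apply Lp.ext
  filter_upwards [ae_all_iff.2 h1, Lp.coeFn_zero H 2 circMeasure] with t h2 h3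
  rw [h3, Pi.zero_apply]
  exact eq_zero_of_inner u h2

/-- The orthonormal basis `{ω^n u_i}` of `L²(∂𝔻; H)` attached to an orthonormal basis `{u_i}`
of `H`. -/
def monomialBasis {ι : Type*} [Countable ι] [CompleteSpace H] (u : HilbertBasis ι ℂ H) :
    HilbertBasis (ι × ℤ) ℂ (L2C H) :=
  HilbertBasis.mkOfOrthogonalEqBot (monomial_orthonormal u) (monomial_complete u)

end Circle

section Models

variable {I J : Type*} [Countable I] [Countable J]

/-- The spectral model of the translation operator: the unitary operator
`𝓕 f = ∑_{i,n} ⟪L_i^{(n)}, f⟫ ω^n u_i`. -/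
def modelF (L : HilbertBasis I ℂ (L2On (Ico 0 1))) (u : HilbertBasis I ℂ (Ell2 I)) :
    L2R ≃ₗᵢ[ℂ] L2C (Ell2 I) :=
  (Lbasis L).repr.trans (monomialBasis u).repr.symm

/-- The spectral model of the dilation operator: the unitary operator
`𝓖 f = ∑_{s,j,m} ⟪K_{s,j}^{(m)}, f⟫ ω^m u_{s,j}`. -/
def modelG (Kp : HilbertBasis J ℂ (L2On (Ico 1 2))) (Km : HilbertBasis J ℂ (L2On (Ioc (-2) (-1))))
    (v : HilbertBasis (J ⊕ J) ℂ (Ell2Sum J)) :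
    L2R ≃ₗᵢ[ℂ] L2C (Ell2Sum J) :=
  (Kbasis Kp Km).repr.trans (monomialBasis v).repr.symm

theorem modelF_hasSum (L : HilbertBasis I ℂ (L2On (Ico 0 1))) (u : HilbertBasis I ℂ (Ell2 I))
    (f : L2R) :
    HasSum (fun p : I × ℤ => inner ℂ (Lfam L p) f • monomial p.2 (u p.1)) (modelF L u f) := by
  have h := (monomialBasis u).hasSum_repr_symm ((Lbasis L).repr f)
  simp only [HilbertBasis.repr_apply_apply] at h
  simpa [monomialBasis, Lbasis, modelF] using h

theorem modelG_hasSum (Kp : HilbertBasis J ℂ (L2On (Ico 1 2)))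
    (Km : HilbertBasis J ℂ (L2On (Ioc (-2) (-1)))) (v : HilbertBasis (J ⊕ J) ℂ (Ell2Sum J))
    (f : L2R) :
    HasSum (fun p : (J ⊕ J) × ℤ => inner ℂ (Kfam Kp Km p) f • monomial p.2 (v p.1))
      (modelG Kp Km v f) := by
  have h := (monomialBasis v).hasSum_repr_symm ((Kbasis Kp Km).repr f)
  simp only [HilbertBasis.repr_apply_apply] at h
  simpa [monomialBasis, Kbasis, modelG] using h

end Models

section Rigid

variable {H : Type*} [NormedAddCommGroup H] [InnerProductSpace ℂ H]

/-- `B` is a partial isometry with initial space `N`. -/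
def IsPartialIsometryOn (B : H →L[ℂ] H) (N : Submodule ℂ H) : Prop :=
  IsClosed (N : Set H) ∧ (∀ x ∈ N, ‖B x‖ = ‖x‖) ∧ ∀ x ∈ Nᗮ, B x = 0

/-- Weak measurability of an operator-valued function on the circle. -/
def WeaklyMeasurable (A : Circ → H →L[ℂ] H) : Prop :=
  ∀ h g : H, Measurable fun t => inner ℂ g (A t h)

/-- `A` is a rigid function with initial space `N`. -/
def IsRigidOn (A : Circ → H →L[ℂ] H) (N : Submodule ℂ H) : Prop :=
  WeaklyMeasurable A ∧ ∀ᵐ t ∂circMeasure, IsPartialIsometryOn (A t) N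

/-- The set `A X = {A v : v ∈ X}`, where `(A v)(ω) = A(ω) v(ω)`, for `X ⊆ L²(∂𝔻; H)`. -/
def opImage (A : Circ → H →L[ℂ] H) (X : Set (L2C H)) : Set (L2C H) :=
  {g | ∃ f ∈ X, ∀ᵐ t ∂circMeasure, g t = A t (f t)}

/-- The constant functions in `L²(∂𝔻; H)`. -/
def constants (H : Type*) [NormedAddCommGroup H] : Set (L2C H) :=
  {f | ∃ c : H, ∀ᵐ t ∂circMeasure, f t = c}

/-- The closed linear span `⟨X⟩`. -/
def closedSpan {E : Type*} [NormedAddCommGroup E] [NormedSpace ℂ E] (X : Set E) :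
    Submodule ℂ E :=
  (Submodule.span ℂ X).topologicalClosure

/-- `⟨ω^k A 𝔠 : k ∈ ℤ⟩`, with `𝔠` the space of constant functions. -/
def shiftSpan (A : Circ → H →L[ℂ] H) : Submodule ℂ (L2C H) :=
  closedSpan (⋃ k : ℤ, opImage (fun t => fourier k t • A t) (constants H))

/-- The Hardy space `H⁺(∂𝔻; H)`: the functions `∑_{k ≥ 0} ω^k a_k` with `∑ ‖a_k‖² < ∞`. -/
def hardyPlus (H : Type*) [NormedAddCommGroup H] [InnerProductSpace ℂ H] :
    Submodule ℂ (L2C H) where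
  carrier := {f | ∃ a : ℕ → H, Summable (fun k => ‖a k‖ ^ 2) ∧
    HasSum (fun k : ℕ => monomial (k : ℤ) (a k)) f}
  zero_mem' := by
    refine ⟨fun _ => 0, by simpa using! (summable_zero : Summable fun _ : ℕ => (0 : ℝ)), ?_⟩
    have h : ∀ n : ℤ, monomial n (0 : H) = 0 := fun n => by
      simpa only [zero_smul] using monomial_smul n 0 (0 : H)
    simp only [h]
    exact hasSum_zero
  add_mem' := by
    rintro f g ⟨a, ha, hf⟩ ⟨b, hb, hg⟩
    refine ⟨a + b, ?_, ?_⟩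
    · refine Summable.of_nonneg_of_le (fun k => by positivity) (fun k => ?_)
        ((ha.add hb).mul_left 2)
      have h := norm_add_le (a k) (b k)
      rw [Pi.add_apply]
      nlinarith [norm_nonneg (a k + b k), sq_nonneg (‖a k‖ - ‖b k‖)]
    · simpa only [Pi.add_apply, monomial_add] using hf.add hg
  smul_mem' := by
    rintro c f ⟨a, ha, hf⟩
    refine ⟨c • a, ?_, ?_⟩
    · simpa only [Pi.smul_apply, norm_smul, mul_pow] using ha.mul_left (‖c‖ ^ 2)
    · simpa only [Pi.smul_apply, monomial_smul] using hf.const_smul c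

/-- `H⁻(∂𝔻; H)`, the orthogonal complement of `H⁺(∂𝔻; H)`. -/
def hardyMinus (H : Type*) [NormedAddCommGroup H] [InnerProductSpace ℂ H] :
    Submodule ℂ (L2C H) :=
  (hardyPlus H)ᗮ

/-- Measurability of a range function: the orthogonal projections are weakly measurable. -/
def IsMeasurableRange [CompleteSpace H] (K : Circ → ClosedSubmodule ℂ H) : Prop :=
  WeaklyMeasurable fun t => (K t).toSubmodule.starProjection

/-- `𝔐_K`: the functions `f ∈ L²(∂𝔻; H)` with `f(ω) ∈ K(ω)` a.e. -/
def rangeSpace (K : Circ → ClosedSubmodule ℂ H) : Set (L2C H) :=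
  {f | ∀ᵐ t ∂circMeasure, f t ∈ K t}

/-- `(R, S)` is a pair of rigid functions with initial spaces `N` and `P`, where `N` is
one-dimensional and `S(ω)` is unitary for a.e. `ω`. -/
structure IsRigidPair {H' : Type*} [NormedAddCommGroup H'] [InnerProductSpace ℂ H']
    [CompleteSpace H'] (R : Circ → H →L[ℂ] H) (N : Submodule ℂ H)
    (S : Circ → H' →L[ℂ] H') (P : Submodule ℂ H') : Prop where
  rigid_left : IsRigidOn R N
  rigid_right : IsRigidOn S P
  one_dim : Module.finrank ℂ N = 1
  unitary_ae : ∀ᵐ t ∂circMeasure, S t ∈ unitary (H' →L[ℂ] H')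

end Rigid

section MRA

/-- The integer translates of `φ` form an orthonormal basis of `W`. -/
def IsTranslateBasis (φ : L2R) (W : Submodule ℂ L2R) : Prop :=
  Orthonormal ℂ (fun k : ℤ => (T ^ k) φ) ∧ closedSpan (range fun k : ℤ => (T ^ k) φ) = W

/-- `V` is a multiresolution analysis of `L²(ℝ)`. -/
structure IsMRA (V : ℤ → Submodule ℂ L2R) : Prop where
  closed : ∀ n, IsClosed (V n : Set L2R)
  mono : ∀ n, V n ≤ V (n + 1)
  inter : ⋂ n, (V n : Set L2R) = {0}
  union : closure (⋃ n, (V n : Set L2R)) = univ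
  dilate : ∀ (n : ℤ) (f : L2R), f ∈ V 0 ↔ (D ^ n) f ∈ V n
  exists_scaling : ∃ φ, IsTranslateBasis φ (V 0)

/-- `φ` is a scaling function of the multiresolution analysis `V`. -/
def IsScalingFunction (φ : L2R) (V : ℤ → Submodule ℂ L2R) : Prop :=
  IsMRA V ∧ IsTranslateBasis φ (V 0)

variable {H H' : Type*} [NormedAddCommGroup H] [InnerProductSpace ℂ H]
  [NormedAddCommGroup H'] [InnerProductSpace ℂ H']

/-- `W = 𝓕⁻¹⟨ω^k R 𝔠 : k ∈ ℤ⟩ = 𝓖⁻¹⟨S H⁻⟩`. -/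
def RepresentsSpace (F : L2R ≃ₗᵢ[ℂ] L2C H) (G : L2R ≃ₗᵢ[ℂ] L2C H')
    (R : Circ → H →L[ℂ] H) (S : Circ → H' →L[ℂ] H') (W : Submodule ℂ L2R) : Prop :=
  (W : Set L2R) = F ⁻¹' (shiftSpan R) ∧
    (W : Set L2R) = G ⁻¹' (closedSpan (opImage S (hardyMinus H')))

/-- `⟨φ⟩ = 𝓕⁻¹⟨R 𝔠⟩`. -/
def RepresentsFunction (F : L2R ≃ₗᵢ[ℂ] L2C H) (R : Circ → H →L[ℂ] H) (φ : L2R) : Prop :=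
  (closedSpan {φ} : Set L2R) = F ⁻¹' (closedSpan (opImage R (constants H)))

end MRA
end
end SpectralMRA

open SpectralMRA

/-!
# Multiresolution analyses in the spectral models of translation and dilation

The operator `𝓕` turns translation into multiplication by `ω`, and `𝓖` turns dilation into
multiplication by `ω` (`modelF_T_zpow`, `modelG_D_zpow`). The two descriptions of `V₀` are then
statements about multiplication by `ω` on `L²(∂𝔻; H)`.

*Translation.* The translates of `φ` are orthonormal iff all Fourier coefficients of `‖𝓕φ(ω)‖²`
except the zeroth vanish and the zeroth is `1`, that is, iff `‖𝓕φ(ω)‖ = 1` a.e.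
(`orthonormal_translates_iff`). A rigid function `R` with initial space `⟨w⟩` is
`R(ω) = ⟪w, ·⟫ R(ω)w`, so `R` carries the same information as the column `ρ = R(·)w`, and
`⟨ω^k R 𝔠 : k ∈ ℤ⟩` is the closed span of the `ω^k ρ` (`shiftSpan_eq`). This is the space of
functions with values in the lines through `ρ(ω)` (`rangeSpace_lineThrough`).

*Dilation.* `M = 𝓖 V₀` is invariant under `ω⁻¹`, the intersection of the `ωⁿM` is zero and their
union is dense. As in the Wold decomposition and the Beurling–Lax–Halmos theorem, the dilates of an
orthonormal basis of `V₁ ⊖ V₀` form an orthonormal basis of `L²(ℝ)`, whose members with negative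
exponents span `V₀` (`IsMRA.exists_wandering`). Vectors `s_i` of `L²(∂𝔻; H)` with all `ω^n s_i`
orthonormal are pointwise orthonormal a.e., hence are the columns of a field of isometries
`A(ω) : ℓ²(κ) → H` (`exists_isometricField`), and completeness makes `A(ω)` onto a.e. The dimensions
of `V₁ ⊖ V₀` and `H` need not be compared: one value `A(ω₀)` identifies `ℓ²(κ)` with `H`, and
`S(ω) = A(ω) A(ω₀)⁻¹` is the required unitary field (`IsMRA.exists_unitary_field`).

*Uniqueness.* A unitary field `S` with `S H⁻ = M` maps the constants onto `ωM ⊖ M`, so two such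
fields differ by a constant unitary factor (`exists_constant_factor`). For `R` the corresponding
statement concerns unit vectors on one line (`exists_constant_factor_of_finrank`).

*Converse.* Multiplication by a unitary field `S` is unitary and commutes with `ω`, so the
properties of `ωⁿH⁻` pass to `ωⁿ S H⁻` and make `𝓖⁻¹(ωⁿ S H⁻)` a multiresolution analysis
(`isMRA_levels`).
-/

namespace SpectralMRA

open MeasureTheory Set Filter Topology
open scoped ENNReal

noncomputable section

/-! ### Closed linear spans and orthonormal families -/

theorem closedSpan_le {E : Type*} [NormedAddCommGroup E] [NormedSpace ℂ E] {X : Set E}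
    {W : Submodule ℂ E} (hW : IsClosed (W : Set E)) (h : ∀ x ∈ X, x ∈ W) : closedSpan X ≤ W :=
  Submodule.topologicalClosure_minimal _ (Submodule.span_le.2 h) hW

theorem subset_closedSpan {E : Type*} [NormedAddCommGroup E] [NormedSpace ℂ E] {X : Set E}
    {x : E} (h : x ∈ X) : x ∈ closedSpan X :=
  Submodule.le_topologicalClosure _ (Submodule.subset_span h)

theorem isClosed_closedSpan {E : Type*} [NormedAddCommGroup E] [NormedSpace ℂ E] (X : Set E) :
    IsClosed (closedSpan X : Set E) :=
  Submodule.isClosed_topologicalClosure _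

/-- A subset of a closed subspace `W` spans `W` if no nonzero vector of `W` is orthogonal to it. -/
theorem closedSpan_eq_of_total {E : Type*} [NormedAddCommGroup E] [InnerProductSpace ℂ E]
    [CompleteSpace E] {X : Set E} {W : Submodule ℂ E} (hW : IsClosed (W : Set E))
    (h : ∀ x ∈ X, x ∈ W) (ht : ∀ f ∈ W, (∀ x ∈ X, inner ℂ x f = 0) → f = 0) :
    closedSpan X = W := by
  have hle := closedSpan_le hW h
  refine le_antisymm hle fun f hf => ?_
  have : CompleteSpace (closedSpan X) := (isClosed_closedSpan X).completeSpace_coe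
  have h0 : f - (closedSpan X).starProjection f = 0 := by
    refine ht _ (W.sub_mem hf (hle (Submodule.starProjection_apply_mem _ _))) fun x hx => ?_
    exact (closedSpan X).sub_starProjection_mem_orthogonal f x (subset_closedSpan hx)
  rw [sub_eq_zero.1 h0]
  exact Submodule.starProjection_apply_mem _ _

theorem closedSpan_image {E F : Type*} [NormedAddCommGroup E] [NormedSpace ℂ E]
    [NormedAddCommGroup F] [NormedSpace ℂ F] [CompleteSpace E] (A : E →ₗᵢ[ℂ] F) (X : Set E) :
    closedSpan (A '' X) = (closedSpan X).map A.toLinearMap := by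
  apply le_antisymm
  · refine closedSpan_le ?_ ?_
    · exact A.isometry.isClosedEmbedding.isClosedMap _ (isClosed_closedSpan X)
    · rintro _ ⟨x, hx, rfl⟩
      exact ⟨x, subset_closedSpan hx, rfl⟩
  · rw [Submodule.map_le_iff_le_comap]
    refine closedSpan_le ?_ fun x hx => subset_closedSpan (mem_image_of_mem A hx)
    exact (isClosed_closedSpan _).preimage A.continuous

theorem closedSpan_image_equiv {E F : Type*} [NormedAddCommGroup E] [NormedSpace ℂ E]
    [NormedAddCommGroup F] [NormedSpace ℂ F] [CompleteSpace E] (A : E ≃ₗᵢ[ℂ] F) (X : Set E) {f : E} :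
    f ∈ closedSpan X ↔ A f ∈ closedSpan (A '' X) := by
  have h := closedSpan_image A.toLinearIsometry X
  have h1 : (A.toLinearIsometry : E → F) '' X = A '' X := rfl
  rw [h1] at h
  rw [h]
  constructor
  · exact fun hf => ⟨f, hf, rfl⟩
  · rintro ⟨g, hg, h2⟩
    rwa [← A.injective h2]

theorem closedSpan_closedSpan {E : Type*} [NormedAddCommGroup E] [NormedSpace ℂ E] (X : Set E) :
    closedSpan (closedSpan X : Set E) = closedSpan X :=
  le_antisymm (closedSpan_le (isClosed_closedSpan X) fun _ h => h)
    fun _ h => subset_closedSpan h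

theorem countable_of_orthonormal {E ι κ : Type*} [NormedAddCommGroup E] [InnerProductSpace ℂ E]
    [Countable ι] (u : HilbertBasis ι ℂ E) {e : κ → E} (he : Orthonormal ℂ e) : Countable κ := by
  have h1 : ∀ i, {k | inner ℂ (e k) (u i) ≠ 0}.Countable := fun i => by
    refine ((he.inner_products_summable (u i)).countable_support).mono fun k hk => ?_
    simpa [Function.mem_support] using hk
  rw [← Set.countable_univ_iff]
  refine (countable_iUnion h1).mono fun k _ => ?_
  by_contra h
  have h2 : e k = 0 := eq_zero_of_inner u fun i => by
    rw [← inner_conj_symm]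
    simp only [mem_iUnion, not_exists, mem_ofPred_eq, not_not] at h
    rw [h i, map_zero]
  have := he.1 k
  simp [h2] at this

/-! ### Fourier coefficients -/

/-- An integrable function on the circle with vanishing Fourier coefficients is zero. -/
theorem ae_eq_zero_of_fourier {f : Circ → ℂ} (hf : Integrable f circMeasure)
    (h : ∀ n : ℤ, ∫ t, fourier n t * f t ∂circMeasure = 0) : f =ᵐ[circMeasure] 0 := by
  have hi : ∀ g : C(Circ, ℂ), Integrable (fun t => g t * f t) circMeasure := fun g =>
    hf.bdd_mul (c := ‖g‖) g.continuous.aestronglyMeasurable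
      (Eventually.of_forall fun t => g.norm_coe_le_norm t)
  let Φ : C(Circ, ℂ) →ₗ[ℂ] ℂ :=
    { toFun := fun g => ∫ t, g t * f t ∂circMeasure
      map_add' := fun g g' => by
        rw [← integral_add (hi g) (hi g')]
        simp [add_mul]
      map_smul' := fun c g => by
        simp [mul_assoc, integral_const_mul] }
  let Ψ : C(Circ, ℂ) →L[ℂ] ℂ := Φ.mkContinuous (∫ t, ‖f t‖ ∂circMeasure) fun g => by
    rw [mul_comm, ← integral_const_mul]
    refine norm_integral_le_of_norm_le (hf.norm.const_mul _) (Eventually.of_forall fun t => ?_)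
    rw [norm_mul]
    exact mul_le_mul_of_nonneg_right (g.norm_coe_le_norm t) (norm_nonneg _)
  have hΨ : ∀ g : C(Circ, ℂ), ∫ t, g t * f t ∂circMeasure = 0 := by
    have h1 : (⊤ : Submodule ℂ C(Circ, ℂ)) ≤ LinearMap.ker Ψ.toLinearMap := by
      rw [← span_fourier_closure_eq_top]
      refine Submodule.topologicalClosure_minimal _ (Submodule.span_le.2 ?_) Ψ.isClosed_ker
      rintro _ ⟨n, rfl⟩
      exact h n
    exact fun g => h1 (Submodule.mem_top (x := g))
  -- the indicator of a closed set is a bounded limit of continuous functions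
  refine ae_eq_zero_of_forall_setIntegral_isClosed_eq_zero hf fun s hs => ?_
  let δ : ℕ → ℝ := fun n => 1 / (n + 1)
  have δpos : ∀ n, 0 < δ n := fun n => by positivity
  have δlim : Tendsto δ atTop (𝓝 0) := tendsto_one_div_add_atTop_nhds_zero_nat
  have hlim : Tendsto (fun n => ∫ t, ((thickenedIndicator (δpos n) s t : ℝ) : ℂ) * f t ∂circMeasure)
      atTop (𝓝 (∫ t, s.indicator f t ∂circMeasure)) := by
    refine tendsto_integral_of_dominated_convergence (fun t => ‖f t‖) (fun n => ?_) hf.norm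
      (fun n => Eventually.of_forall fun t => ?_) (Eventually.of_forall fun t => ?_)
    · refine AEStronglyMeasurable.mul ?_ hf.1
      exact Continuous.aestronglyMeasurable (by fun_prop)
    · rw [norm_mul]
      refine mul_le_of_le_one_left (norm_nonneg _) ?_
      rw [Complex.norm_real, Real.norm_of_nonneg (by positivity)]
      exact_mod_cast thickenedIndicator_le_one (δpos n) s t
    · have h1 := (tendsto_pi_nhds.1 (thickenedIndicator_tendsto_indicator_closure δpos δlim s)) t
      rw [hs.closure_eq] at h1
      have h2 : Tendsto (fun n => ((thickenedIndicator (δpos n) s t : ℝ) : ℂ)) atTop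
          (𝓝 (((s.indicator (fun _ => (1 : NNReal)) t : NNReal) : ℝ) : ℂ)) :=
        (Complex.continuous_ofReal.tendsto _).comp ((NNReal.continuous_coe.tendsto _).comp h1)
      have h3 := h2.mul_const (f t)
      convert h3 using 2
      by_cases ht : t ∈ s <;> simp [ht]
  rw [← integral_indicator hs.measurableSet]
  refine tendsto_nhds_unique hlim ?_
  have : ∀ n, ∫ t, ((thickenedIndicator (δpos n) s t : ℝ) : ℂ) * f t ∂circMeasure = 0 := fun n =>
    hΨ ⟨fun t => ((thickenedIndicator (δpos n) s t : ℝ) : ℂ), by fun_prop⟩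
  simp only [this]
  exact tendsto_const_nhds

/-! ### Multiplication operators -/

section Field

variable {H H' : Type*} [NormedAddCommGroup H] [InnerProductSpace ℂ H]
  [NormedAddCommGroup H'] [InnerProductSpace ℂ H']

/-- Weak measurability implies strong measurability, by expansion in a countable basis. -/
theorem aestronglyMeasurable_of_inner {ι : Type*} [Countable ι] (u : HilbertBasis ι ℂ H)
    {f : Circ → H} (hf : ∀ i, AEStronglyMeasurable (fun t => inner ℂ (u i) (f t)) circMeasure) :
    AEStronglyMeasurable f circMeasure := by
  refine aestronglyMeasurable_of_tendsto_ae (u := atTop)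
    (f := fun (s : Finset ι) t => ∑ i ∈ s, inner ℂ (u i) (f t) • u i) (fun s => ?_)
    (Eventually.of_forall fun t => ?_)
  · exact Finset.aestronglyMeasurable_fun_sum s fun i _ => (hf i).smul_const (u i)
  · have h := u.hasSum_repr (f t)
    simp only [HilbertBasis.repr_apply_apply] at h
    exact h

/-- A strongly measurable field of operators `H → H'` over the circle that is isometric almost
everywhere. -/
structure IsIsometricField (A : Circ → H →L[ℂ] H') : Prop where
  meas : ∀ h, AEStronglyMeasurable (fun t => A t h) circMeasure
  norm_eq : ∀ᵐ t ∂circMeasure, ∀ h, ‖A t h‖ = ‖h‖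

variable {A : Circ → H →L[ℂ] H'}

theorem aestronglyMeasurable_apply
    (hA : ∀ h, AEStronglyMeasurable (fun t => A t h) circMeasure) {f : Circ → H}
    (hf : AEStronglyMeasurable f circMeasure) :
    AEStronglyMeasurable (fun t => A t (f t)) circMeasure := by
  have hs : ∀ g : SimpleFunc Circ H, AEStronglyMeasurable (fun t => A t (g t)) circMeasure := by
    intro g
    induction g using SimpleFunc.induction with
    | const c hs =>
      refine ((hA c).indicator hs).congr (Eventually.of_forall fun t => ?_)
      simp only [SimpleFunc.coe_piecewise, SimpleFunc.coe_const]
      by_cases ht : t ∈ ‹Set Circ› <;> simp [ht]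
    | add _ h1 h2 =>
      simpa using! h1.add h2
  obtain ⟨g, hg, hfg⟩ := hf
  refine aestronglyMeasurable_of_tendsto_ae (u := atTop) (f := fun n t => A t (hg.approx n t))
    (fun n => hs _) ?_
  filter_upwards [hfg] with t ht
  rw [ht]
  exact ((A t).continuous.tendsto _).comp (hg.tendsto_approx t)

theorem IsIsometricField.memLp (hA : IsIsometricField A) (f : L2C H) :
    MemLp (fun t => A t (f t)) 2 circMeasure := by
  refine (Lp.memLp f).of_le (aestronglyMeasurable_apply hA.meas (Lp.aestronglyMeasurable f)) ?_
  filter_upwards [hA.norm_eq] with t ht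
  rw [ht]

/-- The isometry `f ↦ A(·) f(·)` defined by an isometric field. -/
def mulOp (A : Circ → H →L[ℂ] H') (hA : IsIsometricField A) : L2C H →ₗᵢ[ℂ] L2C H' where
  toFun f := (hA.memLp f).toLp
  map_add' f g := by
    rw [← MemLp.toLp_add]
    apply MemLp.toLp_congr
    filter_upwards [Lp.coeFn_add f g] with t ht
    rw [ht, Pi.add_apply, Pi.add_apply, map_add]
  map_smul' c f := by
    rw [RingHom.id_apply, ← MemLp.toLp_const_smul]
    apply MemLp.toLp_congr
    filter_upwards [Lp.coeFn_smul c f] with t ht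
    rw [ht, Pi.smul_apply, Pi.smul_apply, map_smul]
  norm_map' f := by
    change ‖(hA.memLp f).toLp‖ = _
    rw [Lp.norm_toLp, Lp.norm_def]
    congr 1
    apply eLpNorm_congr_norm_ae
    filter_upwards [hA.norm_eq] with t ht
    rw [ht]

theorem mulOp_ae (hA : IsIsometricField A) (f : L2C H) :
    mulOp A hA f =ᵐ[circMeasure] fun t => A t (f t) :=
  MemLp.coeFn_toLp (hA.memLp f)

theorem norm_fourier_apply (k : ℤ) (t : Circ) : ‖fourier k t‖ = 1 := Circle.norm_coe _

theorem isIsometricField_fourier (k : ℤ) :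
    IsIsometricField (fun t : Circ => fourier k t • ContinuousLinearMap.id ℂ H) := by
  refine ⟨fun h => ?_, Eventually.of_forall fun t h => ?_⟩
  · exact Continuous.aestronglyMeasurable (by simp only [smul_apply]; fun_prop)
  · rw [smul_apply, norm_smul, norm_fourier_apply, one_mul, ContinuousLinearMap.id_apply]

/-- Multiplication by `ω^k` on `L²(∂𝔻; H)`. -/
def shift (H : Type*) [NormedAddCommGroup H] [InnerProductSpace ℂ H] (k : ℤ) :
    L2C H →ₗᵢ[ℂ] L2C H :=
  mulOp _ (isIsometricField_fourier k)

theorem shift_ae (k : ℤ) (f : L2C H) :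
    shift H k f =ᵐ[circMeasure] fun t => fourier k t • f t := by
  filter_upwards [mulOp_ae (isIsometricField_fourier k) f] with t ht
  exact ht

theorem shift_shift (k m : ℤ) (f : L2C H) : shift H k (shift H m f) = shift H (k + m) f := by
  apply Lp.ext
  filter_upwards [shift_ae k (shift H m f), shift_ae m f, shift_ae (k + m) f] with t h1 h2 h3
  rw [h1, h2, h3, smul_smul, fourier_add]

theorem shift_zero (f : L2C H) : shift H 0 f = f := by
  apply Lp.ext
  filter_upwards [shift_ae 0 f] with t h1
  rw [h1, fourier_zero, one_smul]

theorem shift_monomial (k n : ℤ) (h : H) : shift H k (monomial n h) = monomial (k + n) h := by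
  apply Lp.ext
  filter_upwards [shift_ae k (monomial n h), monomial_ae n h, monomial_ae (k + n) h]
    with t h1 h2 h3
  rw [h1, h2, h3, smul_smul, fourier_add]

theorem inner_shift_left (k : ℤ) (f g : L2C H) :
    inner ℂ (shift H k f) g = inner ℂ f (shift H (-k) g) := by
  rw [← (shift H (-k)).inner_map_map, shift_shift]
  simp [shift_zero]

theorem mulOp_shift (hA : IsIsometricField A) (k : ℤ) (f : L2C H) :
    mulOp A hA (shift H k f) = shift H' k (mulOp A hA f) := by
  apply Lp.ext
  filter_upwards [mulOp_ae hA (shift H k f), shift_ae k f, shift_ae k (mulOp A hA f),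
    mulOp_ae hA f] with t h1 h2 h3 h4
  rw [h1, h2, h3, h4, map_smul]

theorem mulOp_monomial_ae (hA : IsIsometricField A) (n : ℤ) (h : H) :
    mulOp A hA (monomial n h) =ᵐ[circMeasure] fun t => fourier n t • A t h := by
  filter_upwards [mulOp_ae hA (monomial n h), monomial_ae n h] with t h1 h2
  rw [h1, h2, map_smul]

theorem opImage_eq_image {A' : Circ → H →L[ℂ] H}
    (hA : IsIsometricField A') (X : Set (L2C H)) : opImage A' X = mulOp A' hA '' X := by
  ext g
  constructor
  · rintro ⟨f, hf, hg⟩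
    refine ⟨f, hf, Lp.ext ?_⟩
    filter_upwards [hg, mulOp_ae hA f] with t h1 h2
    rw [h1, h2]
  · rintro ⟨f, hf, rfl⟩
    exact ⟨f, hf, mulOp_ae hA f⟩

/-- The monomials `ω^n u_i` are total in `L²(∂𝔻; H)`. -/
theorem eq_zero_of_inner_monomial {ι : Type*} [Countable ι] (u : HilbertBasis ι ℂ H) {f : L2C H}
    (h : ∀ n i, inner ℂ (monomial n (u i)) f = 0) : f = 0 := by
  have h1 : f ∈ (Submodule.span ℂ (range fun p : ι × ℤ => monomial p.2 (u p.1)))ᗮ := by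
    rw [Submodule.mem_orthogonal]
    intro x hx
    induction hx using Submodule.span_induction with
    | mem x hx => obtain ⟨p, rfl⟩ := hx; exact h _ _
    | zero => simp
    | add x y _ _ hx hy => rw [inner_add_left, hx, hy, add_zero]
    | smul c x _ hx => rw [inner_smul_left, hx, mul_zero]
  rwa [monomial_complete u, Submodule.mem_bot] at h1

theorem norm_monomial (n : ℤ) (h : H) : ‖monomial n h‖ = ‖h‖ := by
  have h1 := inner_monomial_monomial n n h h
  rw [if_pos rfl, inner_self_eq_norm_sq_to_K, inner_self_eq_norm_sq_to_K] at h1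
  have h2 : ‖monomial n h‖ ^ 2 = ‖h‖ ^ 2 := by exact_mod_cast h1
  exact (sq_eq_sq₀ (norm_nonneg _) (norm_nonneg _)).1 h2

/-- If `⟪ω^n f, g⟫ = 0` for `n ≠ 0`, then `⟪f(ω), g(ω)⟫` is constant. -/
theorem inner_ae_eq {f g : L2C H} {c : ℂ}
    (h : ∀ n : ℤ, inner ℂ (shift H n f) g = if n = 0 then c else 0) :
    ∀ᵐ t ∂circMeasure, inner ℂ (f t) (g t) = c := by
  have hi : Integrable (fun t => inner ℂ (f t) (g t) - c) circMeasure :=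
    (L2.integrable_inner (𝕜 := ℂ) f g).sub (integrable_const c)
  have := ae_eq_zero_of_fourier hi fun n => ?_
  · filter_upwards [this] with t ht
    exact sub_eq_zero.1 ht
  have h1 : ∫ t, fourier n t * inner ℂ (f t) (g t) ∂circMeasure = if n = 0 then c else 0 := by
    have h2 := h (-n)
    simp only [neg_eq_zero] at h2
    rw [← h2, L2.inner_def]
    apply integral_congr_ae
    filter_upwards [shift_ae (-n) f] with t ht
    rw [ht, inner_smul_left, fourier_neg, Complex.conj_conj]
  have h3 : ∫ t : Circ, fourier n t * c ∂circMeasure = if n = 0 then c else 0 := by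
    rw [integral_mul_const]
    have := congrFun (fourierCoeff_fourier (T := 1) n) 0
    rw [fourierCoeff] at this
    simp only [neg_zero, fourier_zero, one_smul] at this
    rw [this, Pi.single_apply]
    simp only [eq_comm]
    split_ifs <;> simp
  have hb : ∀ g : Circ → ℂ, Integrable g circMeasure →
      Integrable (fun t => fourier n t * g t) circMeasure := fun g hg =>
    hg.bdd_mul (c := 1) (fourier n).continuous.aestronglyMeasurable
      (Eventually.of_forall fun t => (norm_fourier_apply n t).le)
  simp only [mul_sub]
  rw [integral_sub (hb _ (L2.integrable_inner f g)) (hb _ (integrable_const c)), h1, h3, sub_self]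

end Field

/-! ### Isometric fields with prescribed columns -/

section Field

variable {H H' : Type*} [NormedAddCommGroup H] [InnerProductSpace ℂ H]
  [NormedAddCommGroup H'] [InnerProductSpace ℂ H']

open Classical in
/-- The operator taking the `i`-th vector of the Hilbert basis `e` to `s i`, if the family `s` is
orthonormal, and zero otherwise. -/
def basisMap {κ : Type*} [CompleteSpace H'] (e : HilbertBasis κ ℂ H) (s : κ → H') : H →L[ℂ] H' :=
  if hs : Orthonormal ℂ s then
    (hs.orthogonalFamily.linearIsometry.comp e.repr.toLinearIsometry).toContinuousLinearMap
  else 0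

theorem norm_basisMap {κ : Type*} [CompleteSpace H'] (e : HilbertBasis κ ℂ H) {s : κ → H'}
    (hs : Orthonormal ℂ s) (h : H) : ‖basisMap e s h‖ = ‖h‖ := by
  rw [basisMap, dif_pos hs]
  exact LinearIsometry.norm_map _ h

theorem basisMap_hasSum {κ : Type*} [CompleteSpace H'] (e : HilbertBasis κ ℂ H) {s : κ → H'}
    (hs : Orthonormal ℂ s) (h : H) :
    HasSum (fun i => inner ℂ (e i) h • s i) (basisMap e s h) := by
  rw [basisMap, dif_pos hs]
  have h1 := hs.orthogonalFamily.hasSum_linearIsometry (e.repr h)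
  simp only [HilbertBasis.repr_apply_apply, LinearIsometry.toSpanSingleton_apply] at h1
  exact h1

theorem basisMap_apply_basis {κ : Type*} [CompleteSpace H'] (e : HilbertBasis κ ℂ H) {s : κ → H'}
    (hs : Orthonormal ℂ s) (i : κ) : basisMap e s (e i) = s i := by
  refine (basisMap_hasSum e hs (e i)).unique ?_
  convert hasSum_single i fun j hj => ?_ using 1
  · rw [inner_self_eq_norm_sq_to_K, e.orthonormal.1]
    simp
  · rw [e.orthonormal.2 hj, zero_smul]

theorem measurable_inner_basisMap {κ : Type*} [Countable κ] [CompleteSpace H']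
    (e : HilbertBasis κ ℂ H) {s : κ → Circ → H'} (hs : ∀ i, StronglyMeasurable (s i))
    (h : H) (g : H') :
    Measurable fun t => inner ℂ g (basisMap e (fun i => s i t) h) := by
  classical
  let G : Set Circ := {t | Orthonormal ℂ fun i => s i t}
  have hG : MeasurableSet G := by
    have : G = ⋂ i, ⋂ j, {t | inner ℂ (s i t) (s j t) = if i = j then (1 : ℂ) else 0} := by
      ext t
      simp only [G, mem_iInter, mem_ofPred_eq]
      exact orthonormal_iff_ite
    rw [this]
    refine MeasurableSet.iInter fun i => MeasurableSet.iInter fun j => ?_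
    exact measurableSet_eq_fun ((hs i).inner (hs j)).measurable measurable_const
  refine measurable_of_tendsto_metrizable' (u := atTop) (f := fun (a : Finset κ) t =>
    G.indicator (fun t => ∑ i ∈ a, inner ℂ (e i) h * inner ℂ g (s i t)) t) (fun a => ?_) ?_
  · refine Measurable.indicator ?_ hG
    refine Finset.measurable_fun_sum a fun i _ => measurable_const.mul ?_
    exact (stronglyMeasurable_const.inner (hs i)).measurable
  · refine tendsto_pi_nhds.2 fun t => ?_
    by_cases ht : t ∈ G
    · have h1 := (innerSL ℂ g).hasSum (basisMap_hasSum e ht h)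
      simp only [innerSL_apply_apply, inner_smul_right] at h1
      simp only [indicator_of_mem ht]
      exact h1
    · have h1 : basisMap e (fun i => s i t) = 0 := dif_neg ht
      simp only [indicator_of_notMem ht, h1, zero_apply, inner_zero_right]
      exact tendsto_const_nhds

/-- A family `s` for which the `ω^n s_i` are orthonormal in `L²(∂𝔻; H')` consists of the images of
an orthonormal basis under an isometric field. -/
theorem exists_isometricField {κ ι : Type*} [Countable κ] [Countable ι] [CompleteSpace H']
    (e : HilbertBasis κ ℂ H) (u : HilbertBasis ι ℂ H') (s : κ → L2C H')
    (hs : ∀ i j n, inner ℂ (shift H' n (s i)) (s j) = if n = 0 then inner ℂ (s i) (s j) else 0)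
    (ho : Orthonormal ℂ s) :
    ∃ A : Circ → H →L[ℂ] H', (∀ h g, Measurable fun t => inner ℂ g (A t h)) ∧
      ∃ hA : IsIsometricField A, ∀ i, mulOp A hA (monomial 0 (e i)) = s i := by
  classical
  have hm := fun h g => measurable_inner_basisMap e (fun i => Lp.stronglyMeasurable (s i)) h g
  have hae : ∀ᵐ t ∂circMeasure, Orthonormal ℂ fun i => s i t := by
    have h1 : ∀ i j, ∀ᵐ t ∂circMeasure, inner ℂ (s i t) (s j t) = if i = j then (1 : ℂ) else 0 := by
      intro i j
      refine inner_ae_eq fun n => ?_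
      rw [hs, orthonormal_iff_ite.1 ho]
    filter_upwards [ae_all_iff.2 fun i => ae_all_iff.2 fun j => h1 i j] with t ht
    exact orthonormal_iff_ite.2 ht
  have hA : IsIsometricField fun t => basisMap e fun i => s i t := by
    refine ⟨fun h => aestronglyMeasurable_of_inner u fun i => ?_, ?_⟩
    · exact (hm h (u i)).aestronglyMeasurable
    · filter_upwards [hae] with t ht
      exact norm_basisMap e ht
  refine ⟨_, hm, hA, fun i => Lp.ext ?_⟩
  filter_upwards [mulOp_monomial_ae hA 0 (e i), hae] with t h1 h2
  rw [h1, fourier_zero, one_smul, basisMap_apply_basis e h2]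

theorem ae_surjective_of_mulOp_surjective {ι : Type*} [Countable ι] [CompleteSpace H]
    (u : HilbertBasis ι ℂ H') {A : Circ → H →L[ℂ] H'} (hA : IsIsometricField A)
    (h : Function.Surjective (mulOp A hA)) :
    ∀ᵐ t ∂circMeasure, Function.Surjective (A t) := by
  choose f hf using fun i => h (monomial 0 (u i))
  have h1 : ∀ i, ∀ᵐ t ∂circMeasure, A t (f i t) = u i := fun i => by
    filter_upwards [mulOp_ae hA (f i), monomial_ae 0 (u i)] with t h2 h3
    rw [← h2, hf, h3, fourier_zero, one_smul]
  filter_upwards [ae_all_iff.2 h1, hA.norm_eq] with t h2 h3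
  let B : H →ₗᵢ[ℂ] H' := ⟨(A t).toLinearMap, h3⟩
  have hc : IsClosed (LinearMap.range B.toLinearMap : Set H') :=
    B.isometry.isClosedEmbedding.isClosed_range
  have h4 : (⊤ : Submodule ℂ H') ≤ LinearMap.range B.toLinearMap := by
    rw [← u.dense_span]
    refine Submodule.topologicalClosure_minimal _ (Submodule.span_le.2 ?_) hc
    rintro _ ⟨i, rfl⟩
    exact ⟨f i t, h2 i⟩
  exact fun y => h4 (Submodule.mem_top (x := y))

theorem mulOp_surjective_of_total [CompleteSpace H] [CompleteSpace H'] {A : Circ → H →L[ℂ] H'}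
    (hA : IsIsometricField A)
    {X : Set (L2C H)} (ht : ∀ g, (∀ f ∈ X, inner ℂ (mulOp A hA f) g = 0) → g = 0) :
    Function.Surjective (mulOp A hA) := by
  have h1 : closedSpan (mulOp A hA '' X) = ⊤ := by
    refine closedSpan_eq_of_total isClosed_univ (fun _ _ => Submodule.mem_top) fun g _ hg => ?_
    exact ht g fun f hf => hg _ (mem_image_of_mem _ hf)
  rw [closedSpan_image] at h1
  intro g
  obtain ⟨f, -, hf⟩ := h1 ▸ Submodule.mem_top (R := ℂ) (x := g)
  exact ⟨f, hf⟩

section Unitary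

variable [CompleteSpace H] {ι : Type*} [Countable ι] {S : Circ → H →L[ℂ] H}

theorem isIsometricField_of_unitary (u : HilbertBasis ι ℂ H) (hw : WeaklyMeasurable S)
    (hu : ∀ᵐ t ∂circMeasure, S t ∈ unitary (H →L[ℂ] H)) : IsIsometricField S := by
  refine ⟨fun h => aestronglyMeasurable_of_inner u fun i => (hw h (u i)).aestronglyMeasurable, ?_⟩
  filter_upwards [hu] with t ht h
  exact ContinuousLinearMap.norm_map_of_mem_unitary ht h

theorem weaklyMeasurable_star (hw : WeaklyMeasurable S) : WeaklyMeasurable fun t => star (S t) := by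
  intro h g
  have h1 : (fun t => inner ℂ g (star (S t) h)) = fun t => star (inner ℂ h (S t g)) := by
    funext t
    rw [ContinuousLinearMap.star_eq_adjoint, ContinuousLinearMap.adjoint_inner_right,
      ← inner_conj_symm]
    rfl
  rw [h1]
  exact continuous_star.measurable.comp (hw g h)

/-- The inverse is multiplication by the adjoint field. -/
theorem mulOp_surjective_of_unitary (u : HilbertBasis ι ℂ H) (hw : WeaklyMeasurable S)
    (hu : ∀ᵐ t ∂circMeasure, S t ∈ unitary (H →L[ℂ] H)) (hS : IsIsometricField S) :
    Function.Surjective (mulOp S hS) := by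
  have hS' : IsIsometricField fun t => star (S t) := by
    refine isIsometricField_of_unitary u (weaklyMeasurable_star hw) ?_
    filter_upwards [hu] with t ht
    exact Unitary.star_mem ht
  intro g
  refine ⟨mulOp _ hS' g, Lp.ext ?_⟩
  filter_upwards [mulOp_ae hS (mulOp _ hS' g), mulOp_ae hS' g, hu] with t h1 h2 h3
  rw [h1, h2, ← mul_apply_eq_comp, Unitary.mul_star_self_of_mem h3]
  rfl

end Unitary

/-! ### Hardy spaces -/

theorem mem_hardyMinus_iff {f : L2C H} :
    f ∈ hardyMinus H ↔ ∀ n : ℤ, 0 ≤ n → ∀ h, inner ℂ (monomial n h) f = 0 := by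
  have hz : ∀ n : ℤ, monomial n (0 : H) = 0 := fun n => by
    simpa only [zero_smul] using monomial_smul n 0 (0 : H)
  constructor
  · intro hf n hn h
    obtain ⟨k, rfl⟩ := Int.eq_ofNat_of_zero_le hn
    refine hf _ ⟨Pi.single k h, ?_, ?_⟩
    · refine summable_of_ne_finset_zero (s := {k}) fun j hj => ?_
      rw [Pi.single_eq_of_ne (by simpa using hj)]
      simp
    · convert hasSum_single k fun j hj => ?_ using 1
      · rw [Pi.single_eq_same]
      · rw [Pi.single_eq_of_ne hj, hz]
  · rintro hf g ⟨a, -, hg⟩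
    have h1 := (innerSL ℂ f).hasSum hg
    have h2 : ∀ k : ℕ, inner ℂ f (monomial (k : ℤ) (a k)) = 0 := fun k => by
      rw [← inner_conj_symm, hf _ (Int.natCast_nonneg k), map_zero]
    simp only [innerSL_apply_apply, h2] at h1
    rw [← inner_conj_symm, h1.unique hasSum_zero, map_zero]

theorem monomial_mem_hardyMinus {n : ℤ} (hn : n < 0) (h : H) : monomial n h ∈ hardyMinus H := by
  rw [mem_hardyMinus_iff]
  intro m hm g
  rw [inner_monomial_monomial, if_neg (by omega)]

theorem isClosed_hardyMinus : IsClosed (hardyMinus H : Set (L2C H)) :=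
  Submodule.isClosed_orthogonal _

/-- `H⁻` is the closed span of the monomials with negative exponents. -/
theorem closedSpan_monomial_neg [CompleteSpace H] {ι : Type*} [Countable ι]
    (u : HilbertBasis ι ℂ H) :
    closedSpan (range fun p : ι × {n : ℤ // n < 0} => monomial (p.2 : ℤ) (u p.1))
      = hardyMinus H := by
  refine closedSpan_eq_of_total isClosed_hardyMinus ?_ fun f hf ht => ?_
  · rintro _ ⟨p, rfl⟩
    exact monomial_mem_hardyMinus p.2.2 _
  · refine eq_zero_of_inner_monomial u fun n i => ?_
    rcases le_or_gt 0 n with hn | hn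
    · exact mem_hardyMinus_iff.1 hf n hn _
    · exact ht _ ⟨(i, ⟨n, hn⟩), rfl⟩

/-- `h ↦ ω^n h` as an isometry `H → L²(∂𝔻; H)`. -/
def monomialIsometry (H : Type*) [NormedAddCommGroup H] [InnerProductSpace ℂ H] (n : ℤ) :
    H →ₗᵢ[ℂ] L2C H where
  toFun := monomial n
  map_add' := monomial_add n
  map_smul' c h := monomial_smul n c h
  norm_map' := norm_monomial n

theorem inner_monomial_shift (n k : ℤ) (h : H) (f : L2C H) :
    inner ℂ (monomial n h) (shift H k f) = inner ℂ (monomial (n - k) h) f := by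
  have h1 := inner_shift_left (-k) (monomial n h) f
  rw [neg_neg, shift_monomial] at h1
  rw [← h1, neg_add_eq_sub]

/-- Only the constants lie in `ωH⁻` and are orthogonal to `H⁻`. -/
theorem eq_monomial_zero [CompleteSpace H] {ι : Type*} [Countable ι] (u : HilbertBasis ι ℂ H)
    {f : L2C H} (h1 : shift H (-1) f ∈ hardyMinus H) (h2 : ∀ g ∈ hardyMinus H, inner ℂ g f = 0) :
    ∃ c, f = monomial 0 c := by
  let c : H := ContinuousLinearMap.adjoint (monomialIsometry H 0).toContinuousLinearMap f
  have hc : ∀ h : H, inner ℂ (monomial 0 h) f = inner ℂ h c := fun h =>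
    (ContinuousLinearMap.adjoint_inner_right (monomialIsometry H 0).toContinuousLinearMap h f).symm
  -- `c` is the zeroth Fourier coefficient of `f`; the hypotheses kill the others
  refine ⟨c, sub_eq_zero.1 (eq_zero_of_inner_monomial u fun n i => ?_)⟩
  rw [inner_sub_right, inner_monomial_monomial]
  rcases lt_trichotomy n 0 with hn | rfl | hn
  · rw [h2 _ (monomial_mem_hardyMinus hn _), if_neg hn.ne, sub_zero]
  · rw [hc, if_pos rfl, sub_self]
  · have h3 := mem_hardyMinus_iff.1 h1 (n - 1) (by omega) (u i)
    rw [inner_monomial_shift, sub_neg_eq_add, sub_add_cancel] at h3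
    rw [h3, if_neg hn.ne', sub_zero]

/-- Membership in `⟨S H⁻⟩`, read off before multiplication by `S`. -/
theorem mulOp_mem_hardyImage {S : Circ → H →L[ℂ] H} [CompleteSpace H] (hS : IsIsometricField S)
    {f : L2C H} : mulOp S hS f ∈ closedSpan (opImage S (hardyMinus H)) ↔ f ∈ hardyMinus H := by
  have h1 : closedSpan (hardyMinus H : Set (L2C H)) = hardyMinus H :=
    le_antisymm (closedSpan_le isClosed_hardyMinus fun _ h => h) fun _ h => subset_closedSpan h
  rw [opImage_eq_image hS, closedSpan_image, h1]
  constructor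
  · rintro ⟨g, hg, h⟩
    rwa [← (mulOp S hS).injective h]
  · exact fun h => ⟨f, h, rfl⟩

end Field

/-! ### Rigid functions with one-dimensional initial space -/

section RankOne

variable {H : Type*} [NormedAddCommGroup H] [InnerProductSpace ℂ H]

theorem eq_span_singleton_of_finrank {N : Submodule ℂ H} (hN : Module.finrank ℂ N = 1) {w : H}
    (hw : w ∈ N) (hw1 : ‖w‖ = 1) : N = Submodule.span ℂ {w} := by
  have hw0 : (⟨w, hw⟩ : N) ≠ 0 := by
    intro h
    have h1 : w = 0 := congrArg Subtype.val h
    simp [h1] at hw1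
  apply le_antisymm
  · intro x hx
    obtain ⟨c, hc⟩ := (finrank_eq_one_iff_of_nonzero' _ hw0).1 hN ⟨x, hx⟩
    exact Submodule.mem_span_singleton.2 ⟨c, congrArg Subtype.val hc⟩
  · rw [Submodule.span_le, singleton_subset_iff]
    exact hw

theorem exists_unit_of_finrank {N : Submodule ℂ H} (hN : Module.finrank ℂ N = 1) :
    ∃ w ∈ N, ‖w‖ = 1 := by
  have : Nontrivial N := Module.nontrivial_of_finrank_pos (R := ℂ) (by omega)
  obtain ⟨x, hx⟩ := exists_norm_eq N zero_le_one
  exact ⟨x, x.2, hx⟩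

theorem sub_inner_smul_mem_orthogonal {w : H} (hw1 : ‖w‖ = 1) (h : H) :
    h - inner ℂ w h • w ∈ (Submodule.span ℂ {w})ᗮ := by
  rw [Submodule.mem_orthogonal_singleton_iff_inner_right, inner_sub_right, inner_smul_right,
    inner_self_eq_norm_sq_to_K, hw1]
  simp

theorem isPartialIsometryOn_rankOne {B : H →L[ℂ] H} {w x : H} (hw1 : ‖w‖ = 1) (hx : ‖x‖ = 1)
    (hB : ∀ h, B h = inner ℂ w h • x) : IsPartialIsometryOn B (Submodule.span ℂ {w}) := by
  refine ⟨Submodule.closed_of_finiteDimensional _, fun y hy => ?_, fun y hy => ?_⟩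
  · obtain ⟨c, rfl⟩ := Submodule.mem_span_singleton.1 hy
    rw [hB, inner_smul_right, inner_self_eq_norm_sq_to_K, hw1]
    simp [norm_smul, hx, hw1]
  · rw [hB, Submodule.mem_orthogonal_singleton_iff_inner_right.1 hy, zero_smul]

variable {R : Circ → H →L[ℂ] H} {N : Submodule ℂ H} {w : H}

/-- A rigid function with one-dimensional initial space `⟨w⟩` is `h ↦ ⟪w, h⟫ R(ω)w`. -/
theorem IsRigidOn.apply_eq (hR : IsRigidOn R N) (hN : Module.finrank ℂ N = 1) (hw : w ∈ N)
    (hw1 : ‖w‖ = 1) : ∀ᵐ t ∂circMeasure, ∀ h, R t h = inner ℂ w h • R t w := by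
  filter_upwards [hR.2] with t ht h
  have h1 := ht.2.2 _ ((eq_span_singleton_of_finrank hN hw hw1) ▸
    sub_inner_smul_mem_orthogonal hw1 h)
  rwa [map_sub, map_smul, sub_eq_zero] at h1

/-- The column `R(·)w` is an element of `L²(∂𝔻; H)`, of pointwise norm one. -/
theorem IsRigidOn.exists_column {ι : Type*} [Countable ι] (u : HilbertBasis ι ℂ H)
    (hR : IsRigidOn R N) (hw : w ∈ N) (hw1 : ‖w‖ = 1) :
    ∃ ρ : L2C H, (∀ᵐ t ∂circMeasure, ρ t = R t w) ∧ ∀ᵐ t ∂circMeasure, ‖ρ t‖ = 1 := by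
  have h1 : MemLp (fun t => R t w) 2 circMeasure := by
    refine MemLp.of_bound (aestronglyMeasurable_of_inner u fun i =>
      (hR.1 w (u i)).aestronglyMeasurable) 1 ?_
    filter_upwards [hR.2] with t ht
    rw [ht.2.1 w hw, hw1]
  refine ⟨h1.toLp, h1.coeFn_toLp, ?_⟩
  filter_upwards [h1.coeFn_toLp, hR.2] with t h2 h3
  rw [h2, h3.2.1 w hw, hw1]

/-- `ω^k R 𝔠` is the line through `ω^k ρ`, where `ρ = R(·)w`. -/
theorem opImage_constants {ρ : L2C H}
    (hR : ∀ᵐ t ∂circMeasure, ∀ h, R t h = inner ℂ w h • R t w)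
    (hρ : ∀ᵐ t ∂circMeasure, ρ t = R t w) (k : ℤ) :
    opImage (fun t => fourier k t • R t) (constants H) = range fun c : ℂ => c • shift H k ρ := by
  ext g
  constructor
  · rintro ⟨f, ⟨c, hc⟩, hg⟩
    refine ⟨inner ℂ w c, Lp.ext ?_⟩
    filter_upwards [hg, hc, hR, hρ, Lp.coeFn_smul (inner ℂ w c) (shift H k ρ), shift_ae k ρ]
      with t h1 h2 h3 h4 h5 h6
    rw [h5, h1, Pi.smul_apply, h6, h4, h2, smul_apply, h3 c, smul_comm]
  · rintro ⟨c, rfl⟩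
    refine ⟨monomial 0 (c • w), ⟨c • w, ?_⟩, ?_⟩
    · filter_upwards [monomial_ae 0 (c • w)] with t ht
      rw [ht, fourier_zero, one_smul]
    · filter_upwards [hρ, Lp.coeFn_smul c (shift H k ρ), shift_ae k ρ, monomial_ae 0 (c • w)]
        with t h4 h5 h6 h7
      rw [h5, Pi.smul_apply, h6, h4, h7, fourier_zero, one_smul, smul_apply, map_smul,
        smul_comm]

theorem closedSpan_opImage_constants {ρ : L2C H}
    (hR : ∀ᵐ t ∂circMeasure, ∀ h, R t h = inner ℂ w h • R t w)
    (hρ : ∀ᵐ t ∂circMeasure, ρ t = R t w) :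
    closedSpan (opImage R (constants H)) = closedSpan {ρ} := by
  have h1 := opImage_constants hR hρ 0
  simp only [fourier_zero, one_smul, shift_zero] at h1
  rw [h1]
  refine le_antisymm (closedSpan_le (isClosed_closedSpan _) ?_)
    (closedSpan_le (isClosed_closedSpan _) ?_)
  · rintro _ ⟨c, rfl⟩
    exact Submodule.smul_mem _ _ (subset_closedSpan rfl)
  · rintro _ rfl
    exact subset_closedSpan ⟨1, one_smul _ _⟩

theorem shiftSpan_eq {ρ : L2C H}
    (hR : ∀ᵐ t ∂circMeasure, ∀ h, R t h = inner ℂ w h • R t w)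
    (hρ : ∀ᵐ t ∂circMeasure, ρ t = R t w) :
    shiftSpan R = closedSpan (range fun k => shift H k ρ) := by
  rw [shiftSpan]
  simp only [opImage_constants hR hρ]
  refine le_antisymm (closedSpan_le (isClosed_closedSpan _) ?_)
    (closedSpan_le (isClosed_closedSpan _) ?_)
  · intro x hx
    obtain ⟨k, c, rfl⟩ := mem_iUnion.1 hx
    exact Submodule.smul_mem _ _ (subset_closedSpan ⟨k, rfl⟩)
  · rintro _ ⟨k, rfl⟩
    exact subset_closedSpan (mem_iUnion.2 ⟨k, 1, one_smul _ _⟩)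

theorem isIsometricField_column {ρ : L2C H} (hρ : ∀ᵐ t ∂circMeasure, ‖ρ t‖ = 1) :
    IsIsometricField fun t => ContinuousLinearMap.toSpanSingleton ℂ (ρ t) := by
  refine ⟨fun c => ?_, ?_⟩
  · simp only [ContinuousLinearMap.toSpanSingleton_apply]
    exact (Lp.aestronglyMeasurable ρ).const_smul c
  · filter_upwards [hρ] with t ht c
    rw [ContinuousLinearMap.toSpanSingleton_apply, norm_smul, ht, mul_one]

theorem mulOp_column_monomial {ρ : L2C H} (hρ : ∀ᵐ t ∂circMeasure, ‖ρ t‖ = 1) (k : ℤ) :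
    mulOp _ (isIsometricField_column hρ) (monomial k 1) = shift H k ρ := by
  apply Lp.ext
  filter_upwards [mulOp_monomial_ae (isIsometricField_column hρ) k 1, shift_ae k ρ] with t h1 h2
  rw [h1, h2, ContinuousLinearMap.toSpanSingleton_apply, one_smul]

theorem orthonormal_shift {ρ : L2C H} (hρ : ∀ᵐ t ∂circMeasure, ‖ρ t‖ = 1) :
    Orthonormal ℂ fun k => shift H k ρ := by
  classical
  rw [orthonormal_iff_ite]
  intro k m
  rw [← mulOp_column_monomial hρ, ← mulOp_column_monomial hρ, LinearIsometry.inner_map_map,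
    inner_monomial_monomial]
  simp

/-- The line spanned by `x`, as a closed subspace. -/
def lineThrough (x : H) : ClosedSubmodule ℂ H where
  toSubmodule := Submodule.span ℂ {x}
  isClosed' := Submodule.closed_of_finiteDimensional _

theorem mem_lineThrough {x y : H} : y ∈ lineThrough x ↔ ∃ c : ℂ, c • x = y :=
  Submodule.mem_span_singleton

theorem isMeasurableRange_lineThrough [CompleteSpace H] (ρ : L2C H) :
    IsMeasurableRange fun t => lineThrough (ρ t) := by
  intro h g
  have h1 : (fun t => inner ℂ g ((lineThrough (ρ t)).toSubmodule.starProjection h))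
      = fun t => inner ℂ (ρ t) h / ((‖ρ t‖ ^ 2 : ℝ) : ℂ) * inner ℂ g (ρ t) := by
    funext t
    change inner ℂ g ((Submodule.span ℂ {ρ t}).starProjection h) = _
    rw [Submodule.starProjection_singleton, inner_smul_right]
    simp
  rw [h1]
  have hm := Lp.stronglyMeasurable ρ
  have h2 : Measurable fun t => inner ℂ (ρ t) h := (hm.inner stronglyMeasurable_const).measurable
  have h3 : Measurable fun t => inner ℂ g (ρ t) := (stronglyMeasurable_const.inner hm).measurable
  have h4 : Measurable fun t => ‖ρ t‖ := hm.norm.measurable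
  exact (h2.div (Complex.measurable_ofReal.comp (h4.pow_const 2))).mul h3

/-- If `‖ρ(ω)‖ = 1` a.e., the functions with values in the lines through `ρ(ω)` are the closed span
of the `ω^k ρ`, because trigonometric polynomials are dense in `L²(∂𝔻)`. -/
theorem rangeSpace_lineThrough [CompleteSpace H] {ρ : L2C H}
    (hρ : ∀ᵐ t ∂circMeasure, ‖ρ t‖ = 1) :
    rangeSpace (fun t => lineThrough (ρ t)) = closedSpan (range fun k => shift H k ρ) := by
  have hA := isIsometricField_column hρ
  have h0 : closedSpan (range fun k : ℤ => monomial k (1 : ℂ)) = ⊤ := by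
    refine closedSpan_eq_of_total isClosed_univ (fun _ _ => Submodule.mem_top) fun f _ hf => ?_
    have : f =ᵐ[circMeasure] 0 := by
      refine ae_eq_zero_of_fourier ((Lp.memLp f).integrable one_le_two) fun n => ?_
      rw [← hf _ ⟨-n, rfl⟩, L2.inner_def]
      apply integral_congr_ae
      filter_upwards [monomial_ae (-n) (1 : ℂ)] with t ht
      rw [ht, inner_smul_left, fourier_neg, Complex.conj_conj]
      simp
    exact Lp.ext (this.trans (Lp.coeFn_zero _ _ _).symm)
  have h1 : (range fun k => shift H k ρ) = mulOp _ hA '' range fun k : ℤ => monomial k (1 : ℂ) := by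
    rw [← range_comp]
    congr 1
    funext k
    exact (mulOp_column_monomial hρ k).symm
  rw [h1, closedSpan_image, h0]
  ext f
  constructor
  · intro hf
    have hm : MemLp (fun t => inner ℂ (ρ t) (f t)) 2 circMeasure := by
      refine (Lp.memLp f).of_le
        ((Lp.aestronglyMeasurable ρ).inner (Lp.aestronglyMeasurable f)) ?_
      filter_upwards [hρ] with t ht
      simpa [ht] using norm_inner_le_norm (𝕜 := ℂ) (ρ t) (f t)
    refine ⟨hm.toLp, Submodule.mem_top, Lp.ext ?_⟩
    change mulOp _ hA hm.toLp =ᵐ[circMeasure] f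
    filter_upwards [hf, hρ, mulOp_ae hA hm.toLp, hm.coeFn_toLp] with t h2 h3 h4 h5
    obtain ⟨c, hc⟩ := mem_lineThrough.1 h2
    rw [h4, h5, ContinuousLinearMap.toSpanSingleton_apply, ← hc, inner_smul_right,
      inner_self_eq_norm_sq_to_K, h3]
    simp
  · rintro ⟨c, -, rfl⟩
    change ∀ᵐ t ∂circMeasure, mulOp _ hA c t ∈ lineThrough (ρ t)
    filter_upwards [mulOp_ae hA c] with t ht
    exact mem_lineThrough.2 ⟨c t, by rw [ht, ContinuousLinearMap.toSpanSingleton_apply]⟩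

end RankOne

/-! ### Translation and dilation in the spectral models -/

section Models

variable {I J : Type*} [Countable I] [Countable J]

theorem linearIsometry_ext_hilbertBasis {ι E F : Type*} [NormedAddCommGroup E]
    [InnerProductSpace ℂ E] [NormedAddCommGroup F] [InnerProductSpace ℂ F]
    (b : HilbertBasis ι ℂ E) {f g : E →ₗᵢ[ℂ] F} (h : ∀ i, f (b i) = g (b i)) : f = g := by
  have h1 : f.toContinuousLinearMap = g.toContinuousLinearMap := by
    refine ContinuousLinearMap.ext_on (s := range b) ?_ ?_
    · exact Submodule.dense_iff_topologicalClosure_eq_top.2 b.dense_span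
    · rintro _ ⟨i, rfl⟩
      exact h i
  ext x
  exact congrArg (fun A : E →L[ℂ] F => A x) h1

theorem repr_trans_apply_basis {ι E F : Type*} [NormedAddCommGroup E]
    [InnerProductSpace ℂ E] [NormedAddCommGroup F] [InnerProductSpace ℂ F]
    (b : HilbertBasis ι ℂ E) (c : HilbertBasis ι ℂ F) (i : ι) :
    (b.repr.trans c.repr.symm) (b i) = c i := by
  classical
  rw [LinearIsometryEquiv.trans_apply, b.repr_self, c.repr_symm_single]

/-- A unitary operator that permutes a basis as multiplication by `ω` permutes the monomials is
carried to multiplication by `ω`. -/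
theorem map_zpow_eq_shift {ι E H : Type*} [Countable ι] [NormedAddCommGroup E]
    [InnerProductSpace ℂ E] [NormedAddCommGroup H] [InnerProductSpace ℂ H] (U : E ≃ₗᵢ[ℂ] E)
    (b : HilbertBasis (ι × ℤ) ℂ E) (F : E ≃ₗᵢ[ℂ] L2C H) (u : ι → H) (e : ι → E)
    (hb : ∀ p, b p = (U ^ p.2) (e p.1)) (hF : ∀ p, F (b p) = monomial p.2 (u p.1)) (k : ℤ) (f : E) :
    F ((U ^ k) f) = shift H k (F f) := by
  have h1 : F.toLinearIsometry.comp (U ^ k).toLinearIsometry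
      = (shift H k).comp F.toLinearIsometry := by
    refine linearIsometry_ext_hilbertBasis b fun p => ?_
    change F ((U ^ k) (b p)) = shift H k (F (b p))
    have h2 : (U ^ k) (b p) = b (p.1, k + p.2) := by
      rw [hb, hb, zpow_add]
      rfl
    rw [h2, hF, hF, shift_monomial]
  exact congrArg (fun A : E →ₗᵢ[ℂ] L2C H => A f) h1

theorem modelF_T_zpow (L : HilbertBasis I ℂ (L2On (Ico 0 1))) (u : HilbertBasis I ℂ (Ell2 I))
    (k : ℤ) (f : L2R) : modelF L u ((T ^ k) f) = shift (Ell2 I) k (modelF L u f) := by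
  refine map_zpow_eq_shift T (Lbasis L) (modelF L u) u
    (fun i => extZero (Ico 0 1) measurableSet_Ico (L i)) (fun p => ?_) (fun p => ?_) k f
  · rw [Lbasis, HilbertBasis.coe_mkOfOrthogonalEqBot]
    rfl
  · refine (repr_trans_apply_basis (Lbasis L) (monomialBasis u) p).trans ?_
    rw [monomialBasis, HilbertBasis.coe_mkOfOrthogonalEqBot]

theorem modelG_D_zpow (Kp : HilbertBasis J ℂ (L2On (Ico 1 2)))
    (Km : HilbertBasis J ℂ (L2On (Ioc (-2) (-1)))) (v : HilbertBasis (J ⊕ J) ℂ (Ell2Sum J))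
    (k : ℤ) (f : L2R) :
    modelG Kp Km v ((D ^ k) f) = shift (Ell2Sum J) k (modelG Kp Km v f) := by
  refine map_zpow_eq_shift D (Kbasis Kp Km) (modelG Kp Km v) v (Kzero Kp Km)
    (fun p => ?_) (fun p => ?_) k f
  · rw [Kbasis, HilbertBasis.coe_mkOfOrthogonalEqBot]
    rfl
  · refine (repr_trans_apply_basis (Kbasis Kp Km) (monomialBasis v) p).trans ?_
    rw [monomialBasis, HilbertBasis.coe_mkOfOrthogonalEqBot]

end Models

/-! ### The wandering subspace of a multiresolution analysis -/

section Wandering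

theorem D_zpow_apply_add (m n : ℤ) (f : L2R) : (D ^ m) ((D ^ n) f) = (D ^ (m + n)) f := by
  rw [zpow_add]
  rfl

theorem IsMRA.mem_iff {V : ℤ → Submodule ℂ L2R} (hV : IsMRA V) (n m : ℤ) (f : L2R) :
    f ∈ V m ↔ (D ^ n) f ∈ V (n + m) := by
  have h1 := hV.dilate m ((D ^ (-m)) f)
  have h2 := hV.dilate (n + m) ((D ^ (-m)) f)
  rw [D_zpow_apply_add] at h1 h2
  simp only [add_neg_cancel, zpow_zero, add_neg_cancel_right] at h1 h2
  exact h1.symm.trans h2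

/-- The wavelet space `V₁ ⊖ V₀` of a multiresolution analysis is wandering for `D`, and its dilates
exhaust both `L²(ℝ)` and, for the negative powers of `D`, the space `V₀`. -/
theorem IsMRA.exists_wandering {V : ℤ → Submodule ℂ L2R} (hV : IsMRA V) :
    ∃ (κ : Type) (e : κ → L2R),
      Orthonormal ℂ (fun p : κ × ℤ => (D ^ p.2) (e p.1)) ∧
      closedSpan (range fun p : κ × {n : ℤ // n < 0} => (D ^ (p.2 : ℤ)) (e p.1)) = V 0 ∧
      ∀ f, (∀ k, ∀ n : ℤ, inner ℂ ((D ^ n) (e k)) f = 0) → f = 0 := by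
  have hcomp : ∀ n, CompleteSpace (V n) := fun n => (hV.closed n).completeSpace_coe
  have hmono : Monotone V := monotone_int_of_le_succ hV.mono
  let W : Submodule ℂ L2R := V 1 ⊓ (V 0)ᗮ
  have hW : IsClosed (W : Set L2R) := (hV.closed 1).inter (Submodule.isClosed_orthogonal _)
  have : CompleteSpace W := hW.completeSpace_coe
  obtain ⟨s, b, -⟩ := exists_hilbertBasis ℂ W
  let e : s → L2R := fun k => (b k : L2R)
  have heW : ∀ k, e k ∈ W := fun k => (b k).2
  have heV : ∀ k n m, n < m → (D ^ n) (e k) ∈ V m := fun k n m h =>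
    hmono (by omega) ((hV.mem_iff n 1 (e k)).1 (heW k).1)
  have heO : ∀ k n m, m ≤ n → ∀ g ∈ V m, inner ℂ g ((D ^ n) (e k)) = 0 := by
    intro k n m h g hg
    have h1 : (D ^ (-n)) g ∈ V 0 := by
      have := (hV.mem_iff (-n) n g).1 (hmono h hg)
      rwa [neg_add_cancel] at this
    have h2 := (heW k).2 _ h1
    rw [inner_zpow_neg] at h2
    simpa using h2
  have hWe : ∀ f ∈ W, (∀ k, inner ℂ (e k) f = 0) → f = 0 := by
    intro f hf h
    have : (⟨f, hf⟩ : W) = 0 := eq_zero_of_inner b fun k => h k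
    exact congrArg Subtype.val this
  -- an element of `V (n + 1)` orthogonal to `D ^ n W` lies in `V n`
  have hstep : ∀ n f, f ∈ V (n + 1) → (∀ k, inner ℂ ((D ^ n) (e k)) f = 0) → f ∈ V n := by
    intro n f hf h
    let p := (V n).starProjection f
    have hp : p ∈ V n := Submodule.starProjection_apply_mem _ _
    have hq : f - p ∈ (V n)ᗮ := (V n).sub_starProjection_mem_orthogonal f
    have hq1 : (D ^ (-n)) (f - p) = 0 := by
      refine hWe _ ⟨?_, fun g hg => ?_⟩ fun k => ?_
      · have := (hV.mem_iff (-n) (n + 1) (f - p)).1 (Submodule.sub_mem _ hf (hV.mono n hp))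
        rwa [neg_add_cancel_left] at this
      · rw [← inner_zpow_neg]
        refine hq _ ?_
        simpa using (hV.mem_iff n 0 g).1 hg
      · rw [← inner_zpow_neg, inner_sub_right, h k, ← inner_conj_symm,
          heO k n n le_rfl p hp, map_zero, sub_zero]
    rw [sub_eq_zero.1 ((LinearIsometryEquiv.map_eq_zero_iff _).1 hq1)]
    exact hp
  -- by `hstep`, an `f` as here descends through all the spaces, whose intersection is zero
  have htot : ∀ m f, f ∈ V m → (∀ k n, n < m → inner ℂ ((D ^ n) (e k)) f = 0) → f = 0 := by
    intro m f hf h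
    have h1 : ∀ n : ℕ, f ∈ V (m - n) := by
      intro n
      induction n with
      | zero => simpa using hf
      | succ n ih =>
        refine hstep _ f ?_ fun k => h k _ (by push_cast; omega)
        convert ih using 2
        push_cast
        ring
    have h2 : f ∈ ⋂ n, (V n : Set L2R) := by
      refine mem_iInter.2 fun n => hmono ?_ (h1 (m - n).toNat)
      omega
    rw [hV.inter] at h2
    exact h2
  refine ⟨s, e, ?_, ?_, ?_⟩
  · refine orthonormal_zpow D e (b.orthonormal.comp_linearIsometry W.subtypeₗᵢ) fun n hn i j => ?_
    rcases lt_or_gt_of_ne hn with h | h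
    · simpa using heO j 0 0 le_rfl _ (heV i n 0 h)
    · rw [inner_zpow_neg, ← inner_conj_symm]
      have := heO i 0 0 le_rfl _ (heV j (-n) 0 (by omega))
      rw [zpow_zero] at this
      change inner ℂ _ (e i) = 0 at this
      rw [this, map_zero]
  · refine closedSpan_eq_of_total (hV.closed 0) ?_ fun f hf h => ?_
    · rintro _ ⟨p, rfl⟩
      exact heV _ _ _ p.2.2
    · exact htot 0 f hf fun k n hn => h _ ⟨(k, ⟨n, hn⟩), rfl⟩
  · intro f hf
    -- the projections of `f` to the spaces `V n` vanish
    have h1 : ∀ n, f ∈ (V n)ᗮ := by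
      intro n
      let p := (V n).starProjection f
      have hp : p ∈ V n := Submodule.starProjection_apply_mem _ _
      have hq : f - p ∈ (V n)ᗮ := (V n).sub_starProjection_mem_orthogonal f
      have hp0 : p = 0 := htot n p hp fun k m hm => by
        have := hq _ (heV k m n hm)
        rwa [inner_sub_right, hf, zero_sub, neg_eq_zero] at this
      rwa [hp0, sub_zero] at hq
    have h2 : IsClosed {g : L2R | inner ℂ g f = 0} :=
      isClosed_eq (by fun_prop) continuous_const
    have h3 : (univ : Set L2R) ⊆ {g : L2R | inner ℂ g f = 0} := by
      rw [← hV.union]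
      refine closure_minimal (iUnion_subset fun n g hg => h1 n g hg) h2
    exact inner_self_eq_zero.1 (h3 (mem_univ f))

end Wandering

/-! ### Unitary fields and subspaces invariant under dilation -/

section Levels

variable {H : Type*} [NormedAddCommGroup H] [InnerProductSpace ℂ H]

/-- The spaces `Vₙ = 𝓖⁻¹(ωⁿ S H⁻)`, encoded as the `f` with `ω⁻ⁿ 𝓖f ∈ ⟨S H⁻⟩`. -/
def levels (G : L2R ≃ₗᵢ[ℂ] L2C H) (S : Circ → H →L[ℂ] H) (n : ℤ) : Submodule ℂ L2R :=
  (closedSpan (opImage S (hardyMinus H))).comap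
    ((shift H (-n)).comp G.toLinearIsometry).toLinearMap

theorem mem_levels {G : L2R ≃ₗᵢ[ℂ] L2C H} {S : Circ → H →L[ℂ] H} {n : ℤ} {f : L2R} :
    f ∈ levels G S n ↔ shift H (-n) (G f) ∈ closedSpan (opImage S (hardyMinus H)) := Iff.rfl

end Levels

section Right

variable {H : Type*} [NormedAddCommGroup H] [InnerProductSpace ℂ H] [CompleteSpace H]
  {ι : Type*} [Countable ι]

theorem mem_unitary_of_isometry_of_surjective {B : H →L[ℂ] H} (h1 : ∀ x, ‖B x‖ = ‖x‖)
    (h2 : Function.Surjective B) : B ∈ unitary (H →L[ℂ] H) := by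
  let B' : H →ₗᵢ[ℂ] H := ⟨B.toLinearMap, h1⟩
  let E : H ≃ₗᵢ[ℂ] H := LinearIsometryEquiv.ofSurjective B' h2
  have h3 := (Unitary.linearIsometryEquiv.symm E).2
  convert h3 using 1
  ext x
  rfl

theorem isRigidOn_top_of_unitary {S : Circ → H →L[ℂ] H} (hw : WeaklyMeasurable S)
    (hu : ∀ᵐ t ∂circMeasure, S t ∈ unitary (H →L[ℂ] H)) : IsRigidOn S ⊤ := by
  refine ⟨hw, ?_⟩
  filter_upwards [hu] with t ht
  refine ⟨isClosed_univ, fun x _ => ContinuousLinearMap.norm_map_of_mem_unitary ht x,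
    fun x hx => ?_⟩
  rw [Submodule.top_orthogonal_eq_bot, Submodule.mem_bot] at hx
  rw [hx, map_zero]

/-- An injective partial isometry has full initial space. -/
theorem IsRigidOn.eq_top_of_unitary {S : Circ → H →L[ℂ] H} {P : Submodule ℂ H}
    (hS : IsRigidOn S P) (hu : ∀ᵐ t ∂circMeasure, S t ∈ unitary (H →L[ℂ] H)) : P = ⊤ := by
  obtain ⟨t, ⟨h1, -, h2⟩, h3⟩ := (hS.2.and hu).exists
  have : CompleteSpace P := h1.completeSpace_coe
  rw [← Submodule.orthogonal_eq_bot_iff, Submodule.eq_bot_iff]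
  intro x hx
  rw [← norm_eq_zero, ← ContinuousLinearMap.norm_map_of_mem_unitary h3 x, h2 x hx, norm_zero]

/-- If `S H⁻ = S' H⁻`, then `S` and `S'` differ by a constant unitary operator: both fields map
the constants onto `ωM ⊖ M`, where `M` is the common space. -/
theorem exists_constant_factor (u : HilbertBasis ι ℂ H) {S S' : Circ → H →L[ℂ] H}
    (hw : WeaklyMeasurable S) (hu : ∀ᵐ t ∂circMeasure, S t ∈ unitary (H →L[ℂ] H))
    (hw' : WeaklyMeasurable S') (hu' : ∀ᵐ t ∂circMeasure, S' t ∈ unitary (H →L[ℂ] H))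
    (h : closedSpan (opImage S (hardyMinus H)) = closedSpan (opImage S' (hardyMinus H))) :
    ∃ U : H →L[ℂ] H, (∀ x, ‖U x‖ = ‖x‖) ∧ Function.Surjective U ∧
      ∀ᵐ t ∂circMeasure, S' t = S t ∘L U := by
  -- a preimage under `S` of `S' x` lies in `ωH⁻` and is orthogonal to `H⁻`, so it is constant
  have key : ∀ (S S' : Circ → H →L[ℂ] H) (hS : IsIsometricField S) (hS' : IsIsometricField S'),
      Function.Surjective (mulOp S hS) → Function.Surjective (mulOp S' hS') →
      closedSpan (opImage S (hardyMinus H)) = closedSpan (opImage S' (hardyMinus H)) →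
      ∀ x, ∃ c, mulOp S hS (monomial 0 c) = mulOp S' hS' (monomial 0 x) := by
    intro S S' hS hS' hs hs' h x
    obtain ⟨f, hf⟩ := hs (mulOp S' hS' (monomial 0 x))
    have h1 : shift H (-1) f ∈ hardyMinus H := by
      rw [← mulOp_mem_hardyImage hS, mulOp_shift, hf, ← mulOp_shift, shift_monomial, h,
        mulOp_mem_hardyImage hS']
      exact monomial_mem_hardyMinus (by norm_num) _
    have h2 : ∀ g ∈ hardyMinus H, inner ℂ g f = 0 := fun g hg => by
      obtain ⟨g', hg'⟩ := hs' (mulOp S hS g)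
      have h3 : g' ∈ hardyMinus H := by
        rwa [← mulOp_mem_hardyImage hS', hg', ← h, mulOp_mem_hardyImage hS]
      rw [← (mulOp S hS).inner_map_map, hf, ← hg', LinearIsometry.inner_map_map,
        ← inner_conj_symm, mem_hardyMinus_iff.1 h3 0 le_rfl, map_zero]
    obtain ⟨c, rfl⟩ := eq_monomial_zero u h1 h2
    exact ⟨c, hf⟩
  have hS := isIsometricField_of_unitary u hw hu
  have hS' := isIsometricField_of_unitary u hw' hu'
  have hs := mulOp_surjective_of_unitary u hw hu hS
  have hs' := mulOp_surjective_of_unitary u hw' hu' hS'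
  have hinj : ∀ (S : Circ → H →L[ℂ] H) (hS : IsIsometricField S) (x y : H),
      mulOp S hS (monomial 0 x) = mulOp S hS (monomial 0 y) → x = y := fun S hS x y hxy =>
    (monomialIsometry H 0).injective ((mulOp S hS).injective hxy)
  choose U hU using key S S' hS hS' hs hs' h
  let U' : H →ₗᵢ[ℂ] H :=
    { toFun := U
      map_add' := fun x y => hinj S hS _ _ <| by
        rw [hU, monomial_add, monomial_add, map_add, map_add, hU, hU]
      map_smul' := fun c x => hinj S hS _ _ <| by
        rw [hU, RingHom.id_apply, monomial_smul, monomial_smul, map_smul, map_smul, hU]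
      norm_map' := fun x => by
        change ‖U x‖ = ‖x‖
        rw [← norm_monomial 0, ← (mulOp S hS).norm_map, hU, LinearIsometry.norm_map,
          norm_monomial] }
  refine ⟨U'.toContinuousLinearMap, U'.norm_map, fun c => ?_, ?_⟩
  · obtain ⟨x, hx⟩ := key S' S hS' hS hs' hs h.symm c
    refine ⟨x, hinj S hS _ _ ?_⟩
    rw [← hx]
    exact hU x
  · have h1 : ∀ i, ∀ᵐ t ∂circMeasure, S' t (u i) = S t (U (u i)) := fun i => by
      filter_upwards [mulOp_monomial_ae hS' 0 (u i), mulOp_monomial_ae hS 0 (U (u i))]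
        with t h1 h2
      rw [hU, h1] at h2
      simpa only [fourier_zero, one_smul] using h2
    filter_upwards [ae_all_iff.2 h1] with t ht
    refine ContinuousLinearMap.ext_on
      (Submodule.dense_iff_topologicalClosure_eq_top.2 u.dense_span) ?_
    rintro _ ⟨i, rfl⟩
    exact ht i

theorem isMRA_levels (v : HilbertBasis ι ℂ H) {G : L2R ≃ₗᵢ[ℂ] L2C H}
    (hG : ∀ (k : ℤ) f, G ((D ^ k) f) = shift H k (G f)) {S : Circ → H →L[ℂ] H}
    (hw : WeaklyMeasurable S) (hu : ∀ᵐ t ∂circMeasure, S t ∈ unitary (H →L[ℂ] H))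
    (hφ : ∃ φ, IsTranslateBasis φ (levels G S 0)) : IsMRA (levels G S) := by
  have hS := isIsometricField_of_unitary v hw hu
  have hs := mulOp_surjective_of_unitary v hw hu hS
  have hmem : ∀ n f g, G f = mulOp S hS g →
      (f ∈ levels G S n ↔ shift H (-n) g ∈ hardyMinus H) := by
    intro n f g hfg
    rw [mem_levels, hfg, ← mulOp_shift, mulOp_mem_hardyImage]
  have hmono : ∀ n, levels G S n ≤ levels G S (n + 1) := by
    intro n f hf
    obtain ⟨g, hg⟩ := hs (G f)
    rw [hmem _ _ g hg.symm, mem_hardyMinus_iff] at hf ⊢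
    intro m hm h
    have := hf (m + 1) (by omega) h
    rw [inner_monomial_shift] at this ⊢
    convert this using 3
    ring
  refine ⟨fun n => ?_, hmono, ?_, ?_, fun n f => ?_, hφ⟩
  · exact (isClosed_closedSpan _).preimage ((shift H (-n)).comp G.toLinearIsometry).continuous
  · refine Subset.antisymm (fun f hf => ?_) ?_
    · obtain ⟨g, hg⟩ := hs (G f)
      have h0 : g = 0 := eq_zero_of_inner_monomial v fun n i => by
        have h1 := (hmem n f g hg.symm).1 (mem_iInter.1 hf n)
        have h2 := mem_hardyMinus_iff.1 h1 0 le_rfl (v i)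
        rw [inner_monomial_shift] at h2
        simpa using h2
      rw [h0, map_zero] at hg
      exact (LinearIsometryEquiv.map_eq_zero_iff G).1 hg.symm
    · rintro _ rfl
      exact mem_iInter.2 fun n => Submodule.zero_mem _
  · have hdir : Directed (· ≤ ·) (levels G S) := (monotone_int_of_le_succ hmono).directed_le
    rw [← Submodule.coe_iSup_of_directed _ hdir, ← Submodule.topologicalClosure_coe,
      (Submodule.topologicalClosure_eq_top_iff).2, Submodule.top_coe]
    rw [Submodule.eq_bot_iff]
    intro f hf
    obtain ⟨g, hg⟩ := hs (G f)
    have h0 : g = 0 := eq_zero_of_inner_monomial v fun n i => by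
      rw [← (mulOp S hS).inner_map_map, hg, ← G.apply_symm_apply (mulOp S hS (monomial n (v i))),
        LinearIsometryEquiv.inner_map_map]
      refine hf _ (Submodule.mem_iSup_of_mem (n + 1) ?_)
      rw [hmem _ _ (monomial n (v i)) (G.apply_symm_apply _), shift_monomial]
      exact monomial_mem_hardyMinus (by omega) _
    rw [h0, map_zero] at hg
    exact (LinearIsometryEquiv.map_eq_zero_iff G).1 hg.symm
  · rw [mem_levels, mem_levels, hG, shift_shift, neg_add_cancel, neg_zero, shift_zero]

/-- The space `V₀` of a multiresolution analysis is `𝓖⁻¹(S H⁻)` for a unitary field `S` that maps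
the constants onto the image of the wavelet space. -/
theorem IsMRA.exists_unitary_field {V : ℤ → Submodule ℂ L2R} (hV : IsMRA V)
    (v : HilbertBasis ι ℂ H) {G : L2R ≃ₗᵢ[ℂ] L2C H}
    (hG : ∀ (k : ℤ) f, G ((D ^ k) f) = shift H k (G f)) :
    ∃ S : Circ → H →L[ℂ] H, WeaklyMeasurable S ∧
      (∀ᵐ t ∂circMeasure, S t ∈ unitary (H →L[ℂ] H)) ∧
      (V 0 : Set L2R) = G ⁻¹' (closedSpan (opImage S (hardyMinus H))) := by
  classical
  obtain ⟨κ, e, heo, heV, het⟩ := hV.exists_wandering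
  have he0 : Orthonormal ℂ e := by
    simpa [Function.comp_def] using
      heo.comp (fun k : κ => (k, (0 : ℤ))) fun a b h => congrArg Prod.fst h
  have hGo : Orthonormal ℂ fun k => G (e k) := he0.comp_linearIsometry G.toLinearIsometry
  have : Countable κ := countable_of_orthonormal (monomialBasis v) hGo
  let b : HilbertBasis κ ℂ (Ell2 κ) := HilbertBasis.ofRepr (LinearIsometryEquiv.refl ℂ _)
  obtain ⟨A, hAm, hA, hAb⟩ := exists_isometricField b v (fun k => G (e k)) (fun i j n => by
    rw [← hG, LinearIsometryEquiv.inner_map_map, LinearIsometryEquiv.inner_map_map]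
    split_ifs with hn
    · simp [hn]
    · have := heo.2 (i := (i, n)) (j := (j, 0)) fun h => hn (congrArg Prod.snd h)
      simpa using this) hGo
  have hAbn : ∀ n k, mulOp A hA (monomial n (b k)) = G ((D ^ n) (e k)) := fun n k => by
    rw [hG, ← hAb k, ← mulOp_shift, shift_monomial, add_zero]
  have hAs : Function.Surjective (mulOp A hA) := by
    refine mulOp_surjective_of_total hA (X := range fun p : κ × ℤ => monomial p.2 (b p.1))
      fun g hg => ?_
    rw [← G.apply_symm_apply g, het (G.symm g) fun k n => ?_, map_zero]
    rw [← G.inner_map_map, G.apply_symm_apply, ← hAbn]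
    exact hg _ ⟨(k, n), rfl⟩
  have hAae := ae_surjective_of_mulOp_surjective v hA hAs
  -- a single value of `A` identifies `ℓ²(κ)` with `H`
  obtain ⟨t₀, ht₀, ht₁⟩ := (hAae.and hA.norm_eq).exists
  let Φ : Ell2 κ ≃ₗᵢ[ℂ] H := LinearIsometryEquiv.ofSurjective ⟨(A t₀).toLinearMap, ht₁⟩ ht₀
  let S : Circ → H →L[ℂ] H := fun t => A t ∘L Φ.symm.toLinearIsometry.toContinuousLinearMap
  have hSA : ∀ t x, S t (Φ x) = A t x := fun t x => congrArg (A t) (Φ.symm_apply_apply x)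
  have hSm : WeaklyMeasurable S := fun h g => hAm (Φ.symm h) g
  have hSu : ∀ᵐ t ∂circMeasure, S t ∈ unitary (H →L[ℂ] H) := by
    filter_upwards [hAae, hA.norm_eq] with t h1 h2
    refine mem_unitary_of_isometry_of_surjective (fun x => ?_) (h1.comp Φ.symm.surjective)
    exact (h2 (Φ.symm x)).trans (Φ.symm.norm_map x)
  have hS := isIsometricField_of_unitary v hSm hSu
  let b' : HilbertBasis κ ℂ H := HilbertBasis.ofRepr Φ.symm
  have hb' : ∀ k, b' k = Φ (b k) := fun k => by
    rw [← b'.repr_symm_single, ← b.repr_symm_single]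
    rfl
  have hSb : ∀ n k, mulOp S hS (monomial n (b' k)) = G ((D ^ n) (e k)) := fun n k => by
    rw [← hAbn]
    apply Lp.ext
    filter_upwards [mulOp_monomial_ae hS n (b' k), mulOp_monomial_ae hA n (b k)] with t h1 h2
    rw [h1, h2, hb', hSA]
  refine ⟨S, hSm, hSu, ?_⟩
  ext f
  rw [opImage_eq_image hS, closedSpan_image, ← closedSpan_monomial_neg b', closedSpan_closedSpan,
    ← closedSpan_image, ← range_comp, SetLike.mem_coe, ← heV, closedSpan_image_equiv G,
    ← range_comp, mem_preimage, SetLike.mem_coe]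
  have : (G ∘ fun p : κ × {n : ℤ // n < 0} => (D ^ (p.2 : ℤ)) (e p.1))
      = mulOp S hS ∘ fun p : κ × {n : ℤ // n < 0} => monomial (p.2 : ℤ) (b' p.1) :=
    funext fun p => (hSb _ _).symm
  rw [this]

end Right

/-! ### Rank-one fields and subspaces invariant under translation -/

section Left

variable {H : Type*} [NormedAddCommGroup H] [InnerProductSpace ℂ H]
  {F : L2R ≃ₗᵢ[ℂ] L2C H}

theorem closedSpan_singleton {E : Type*} [NormedAddCommGroup E] [NormedSpace ℂ E] (x : E) :
    closedSpan {x} = Submodule.span ℂ {x} :=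
  le_antisymm (closedSpan_le (Submodule.closed_of_finiteDimensional _) fun _ h =>
    Submodule.subset_span h) (Submodule.le_topologicalClosure _)

theorem closedSpan_translates (hF : ∀ (k : ℤ) f, F ((T ^ k) f) = shift H k (F f)) (φ : L2R) :
    (closedSpan (range fun k : ℤ => (T ^ k) φ) : Set L2R)
      = F ⁻¹' (closedSpan (range fun k => shift H k (F φ))) := by
  ext f
  rw [SetLike.mem_coe, closedSpan_image_equiv F, ← range_comp, mem_preimage, SetLike.mem_coe]
  have : (F ∘ fun k : ℤ => (T ^ k) φ) = fun k => shift H k (F φ) := funext fun k => hF k φ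
  rw [this]

/-- Orthonormality of the translates says that `‖𝓕φ(ω)‖²` has the Fourier coefficients of the
constant `1`. -/
theorem orthonormal_translates_iff (hF : ∀ (k : ℤ) f, F ((T ^ k) f) = shift H k (F f))
    (φ : L2R) :
    Orthonormal ℂ (fun k : ℤ => (T ^ k) φ) ↔ ∀ᵐ t ∂circMeasure, ‖F φ t‖ = 1 := by
  constructor
  · intro h
    have h1 : ∀ᵐ t ∂circMeasure, inner ℂ (F φ t) (F φ t) = (1 : ℂ) := by
      refine inner_ae_eq fun n => ?_
      rw [← hF, LinearIsometryEquiv.inner_map_map]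
      simpa using orthonormal_iff_ite.1 h n 0
    filter_upwards [h1] with t ht
    have h2 : ‖F φ t‖ ^ 2 = 1 := by rw [norm_sq_eq_re_inner (𝕜 := ℂ), ht, RCLike.one_re]
    exact (pow_eq_one_iff_of_nonneg (norm_nonneg _) two_ne_zero).1 h2
  · intro h
    have h1 := (orthonormal_shift h).comp_linearIsometry F.symm.toLinearIsometry
    convert h1 using 1
    funext k
    change _ = F.symm (shift H k (F φ))
    rw [← hF, F.symm_apply_apply]

theorem closedSpan_singleton_preimage (F : L2R ≃ₗᵢ[ℂ] L2C H) (φ : L2R) :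
    (closedSpan {φ} : Set L2R) = F ⁻¹' (closedSpan {F φ}) := by
  ext f
  rw [SetLike.mem_coe, closedSpan_image_equiv F, image_singleton]
  rfl

/-- Two rigid functions with one-dimensional initial spaces and the same range on the constants
differ by a constant partial isometry. -/
theorem exists_constant_factor_of_finrank {ι : Type*} [Countable ι] (u : HilbertBasis ι ℂ H)
    {R R' : Circ → H →L[ℂ] H} {N N' : Submodule ℂ H}
    (hR : IsRigidOn R N) (hN : Module.finrank ℂ N = 1) (hR' : IsRigidOn R' N')
    (hN' : Module.finrank ℂ N' = 1)
    (h : closedSpan (opImage R (constants H)) = closedSpan (opImage R' (constants H))) :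
    ∃ U : H →L[ℂ] H, IsPartialIsometryOn U N' ∧ U.range = N ∧
      ∀ᵐ t ∂circMeasure, R' t = R t ∘L U := by
  obtain ⟨w, hw, hw1⟩ := exists_unit_of_finrank hN
  obtain ⟨w', hw', hw1'⟩ := exists_unit_of_finrank hN'
  obtain ⟨ρ, hρ, hρ1⟩ := hR.exists_column u hw hw1
  obtain ⟨ρ', hρ', hρ1'⟩ := hR'.exists_column u hw' hw1'
  have hRa := hR.apply_eq hN hw hw1
  have hRa' := hR'.apply_eq hN' hw' hw1'
  rw [closedSpan_opImage_constants hRa hρ, closedSpan_opImage_constants hRa' hρ',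
    closedSpan_singleton, closedSpan_singleton] at h
  obtain ⟨c, hc⟩ := Submodule.mem_span_singleton.1
    (h.ge (Submodule.mem_span_singleton_self ρ'))
  have hcρ : ∀ᵐ t ∂circMeasure, ρ' t = c • ρ t := by
    rw [← hc]
    exact Lp.coeFn_smul c ρ
  have hc1 : ‖c‖ = 1 := by
    obtain ⟨t, h1, h2, h3⟩ := (hcρ.and (hρ1.and hρ1')).exists
    rw [h1, norm_smul, h2, mul_one] at h3
    exact h3
  have hc0 : c ≠ 0 := fun h0 => by simp [h0] at hc1
  let U : H →L[ℂ] H := (innerSL ℂ w').smulRight (c • w)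
  have hU : ∀ x, U x = inner ℂ w' x • c • w := fun x => rfl
  refine ⟨U, ?_, ?_, ?_⟩
  · rw [eq_span_singleton_of_finrank hN' hw' hw1']
    exact isPartialIsometryOn_rankOne hw1' (by rw [norm_smul, hc1, hw1, mul_one]) hU
  · rw [eq_span_singleton_of_finrank hN hw hw1]
    ext x
    rw [Submodule.mem_span_singleton]
    constructor
    · rintro ⟨y, rfl⟩
      exact ⟨inner ℂ w' y * c, mul_smul _ _ _⟩
    · rintro ⟨a, rfl⟩
      refine ⟨(a * c⁻¹) • w', ?_⟩
      change U _ = _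
      rw [hU, inner_smul_right, inner_self_eq_norm_sq_to_K, hw1', smul_smul]
      simp [hc0]
  · filter_upwards [hRa, hRa', hρ, hρ', hcρ] with t h1 h2 h3 h4 h5
    ext x
    rw [ContinuousLinearMap.comp_apply, hU, h2 x, ← h4, h5, h3, map_smul, map_smul]

/-- The field of rank-one operators `h ↦ ⟪w, h⟫ ρ(ω)`. -/
theorem isRigidOn_rankOne {w : H} (hw1 : ‖w‖ = 1) {ρ : L2C H}
    (hρ : ∀ᵐ t ∂circMeasure, ‖ρ t‖ = 1) :
    IsRigidOn (fun t => (innerSL ℂ w).smulRight (ρ t)) (Submodule.span ℂ {w}) := by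
  refine ⟨fun h g => ?_, ?_⟩
  · change Measurable fun t => inner ℂ g (inner ℂ w h • ρ t)
    simp only [inner_smul_right]
    exact ((stronglyMeasurable_const.inner (Lp.stronglyMeasurable ρ)).measurable).const_mul _
  · filter_upwards [hρ] with t ht
    exact isPartialIsometryOn_rankOne hw1 ht fun _ => rfl

end Left

/-! ### Scaling functions and pairs of rigid functions -/

section Correspondence

variable {H H' : Type*} [NormedAddCommGroup H] [InnerProductSpace ℂ H]
  [NormedAddCommGroup H'] [InnerProductSpace ℂ H'] [CompleteSpace H']
  {ι ι' : Type*} [Countable ι] [Countable ι']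
  {F : L2R ≃ₗᵢ[ℂ] L2C H} {G : L2R ≃ₗᵢ[ℂ] L2C H'}

theorem IsScalingFunction.norm_ae (hF : ∀ (k : ℤ) f, F ((T ^ k) f) = shift H k (F f))
    {V : ℤ → Submodule ℂ L2R} {φ : L2R} (h : IsScalingFunction φ V) :
    ∀ᵐ t ∂circMeasure, ‖F φ t‖ = 1 :=
  (orthonormal_translates_iff hF φ).1 h.2.1

theorem IsTranslateBasis.norm_eq_one {φ : L2R} {W : Submodule ℂ L2R}
    (h : IsTranslateBasis φ W) : ‖φ‖ = 1 := by
  simpa using h.1.1 0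

/-- `R(ω) = ⟪w, ·⟫ 𝓕φ(ω)` for any unit vector `w`, while `S` comes from the wavelet space. -/
theorem exists_rigidPair (v : HilbertBasis ι' ℂ H')
    (hF : ∀ (k : ℤ) f, F ((T ^ k) f) = shift H k (F f))
    (hG : ∀ (k : ℤ) f, G ((D ^ k) f) = shift H' k (G f))
    {V : ℤ → Submodule ℂ L2R} {φ : L2R} (h : IsScalingFunction φ V) :
    ∃ R N S P, IsRigidPair (H := H) (H' := H') R N S P ∧ RepresentsSpace F G R S (V 0) ∧
      RepresentsFunction F R φ := by
  have hφ := h.norm_ae hF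
  obtain ⟨S, hSw, hSu, hS⟩ := h.1.exists_unitary_field v hG
  -- a value of `F φ` supplies a unit vector of `H`
  obtain ⟨t₀, hw⟩ := hφ.exists
  set w : H := F φ t₀
  let R : Circ → H →L[ℂ] H := fun t => (innerSL ℂ w).smulRight (F φ t)
  have hRw : ∀ t, R t w = F φ t := fun t => by
    change inner ℂ w w • F φ t = F φ t
    rw [inner_self_eq_norm_sq_to_K, hw]
    simp
  have hR : ∀ᵐ t ∂circMeasure, ∀ x, R t x = inner ℂ w x • R t w :=
    Eventually.of_forall fun t x => by rw [hRw]; rfl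
  have hρ : ∀ᵐ t ∂circMeasure, F φ t = R t w := Eventually.of_forall fun t => (hRw t).symm
  refine ⟨R, Submodule.span ℂ {w}, S, ⊤, ⟨isRigidOn_rankOne hw hφ,
    isRigidOn_top_of_unitary hSw hSu, ?_, hSu⟩, ⟨?_, hS⟩, ?_⟩
  · refine finrank_span_singleton fun h0 => ?_
    simp [h0] at hw
  · rw [shiftSpan_eq hR hρ, ← closedSpan_translates hF, h.2.2]
  · rw [RepresentsFunction, closedSpan_opImage_constants hR hρ, closedSpan_singleton_preimage F]

theorem rigidPair_unique (u : HilbertBasis ι ℂ H) (v : HilbertBasis ι' ℂ H')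
    {W : Submodule ℂ L2R} {φ : L2R}
    {R R' : Circ → H →L[ℂ] H} {N N' : Submodule ℂ H} {S S' : Circ → H' →L[ℂ] H'}
    {P P' : Submodule ℂ H'} (h : IsRigidPair R N S P) (hs : RepresentsSpace F G R S W)
    (hf : RepresentsFunction F R φ) (h' : IsRigidPair R' N' S' P')
    (hs' : RepresentsSpace F G R' S' W) (hf' : RepresentsFunction F R' φ) :
    (∃ U : H →L[ℂ] H, IsPartialIsometryOn U N' ∧ U.range = N ∧
      ∀ᵐ t ∂circMeasure, R' t = R t ∘L U) ∧
    (∃ U : H' →L[ℂ] H', IsPartialIsometryOn U P' ∧ U.range = P ∧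
      ∀ᵐ t ∂circMeasure, S' t = S t ∘L U) := by
  constructor
  · exact exists_constant_factor_of_finrank u h.rigid_left h.one_dim h'.rigid_left h'.one_dim
      (SetLike.coe_injective (F.surjective.preimage_injective (hf.symm.trans hf')))
  · obtain ⟨U, hU1, hU2, hU3⟩ := exists_constant_factor v h.rigid_right.1 h.unitary_ae
      h'.rigid_right.1 h'.unitary_ae
      (SetLike.coe_injective (G.surjective.preimage_injective (hs.2.symm.trans hs'.2)))
    refine ⟨U, ?_, ?_, hU3⟩
    · rw [h'.rigid_right.eq_top_of_unitary h'.unitary_ae]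
      refine ⟨isClosed_univ, fun x _ => hU1 x, fun x hx => ?_⟩
      rw [Submodule.top_orthogonal_eq_bot, Submodule.mem_bot] at hx
      rw [hx, map_zero]
    · rw [h.rigid_right.eq_top_of_unitary h.unitary_ae]
      exact LinearMap.range_eq_top.2 hU2

theorem closedSpan_range_smul {E κ : Type*} [NormedAddCommGroup E] [NormedSpace ℂ E]
    {c : ℂ} (hc : c ≠ 0) (x : κ → E) :
    closedSpan (range fun k => c • x k) = closedSpan (range x) := by
  refine le_antisymm (closedSpan_le (isClosed_closedSpan _) ?_)
    (closedSpan_le (isClosed_closedSpan _) ?_)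
  · rintro _ ⟨k, rfl⟩
    exact Submodule.smul_mem _ _ (subset_closedSpan ⟨k, rfl⟩)
  · rintro _ ⟨k, rfl⟩
    have h1 : c • x k ∈ closedSpan (range fun k => c • x k) := subset_closedSpan ⟨k, rfl⟩
    simpa [smul_smul, hc] using Submodule.smul_mem _ c⁻¹ h1

/-- A scaling function determines its multiresolution analysis, and is determined up to a
unimodular constant by the line it spans. -/
theorem IsScalingFunction.unique {V V' : ℤ → Submodule ℂ L2R} {φ φ' : L2R}
    (h : IsScalingFunction φ V) (h' : IsScalingFunction φ' V')
    (hs : closedSpan {φ'} = closedSpan {φ}) : V' = V ∧ ∃ c : ℂ, ‖c‖ = 1 ∧ φ' = c • φ := by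
  rw [closedSpan_singleton, closedSpan_singleton] at hs
  obtain ⟨c, hc⟩ := Submodule.mem_span_singleton.1 (hs.le (Submodule.mem_span_singleton_self φ'))
  have hc1 : ‖c‖ = 1 := by
    have h1 := h'.2.norm_eq_one
    rwa [← hc, norm_smul, h.2.norm_eq_one, mul_one] at h1
  have hc0 : c ≠ 0 := fun h0 => by simp [h0] at hc1
  have hV0 : V' 0 = V 0 := by
    rw [← h.2.2, ← h'.2.2, ← hc]
    simp only [map_smul]
    exact closedSpan_range_smul hc0 _
  refine ⟨?_, c, hc1, hc.symm⟩
  funext n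
  ext f
  rw [h'.1.mem_iff (-n) n, h.1.mem_iff (-n) n, neg_add_cancel, hV0]

/-- With `V₀` the common space, `S` provides the multiresolution analysis and `R` its scaling
function. -/
theorem exists_scalingFunction (u : HilbertBasis ι ℂ H) (v : HilbertBasis ι' ℂ H')
    (hF : ∀ (k : ℤ) f, F ((T ^ k) f) = shift H k (F f))
    (hG : ∀ (k : ℤ) f, G ((D ^ k) f) = shift H' k (G f))
    {R : Circ → H →L[ℂ] H} {N : Submodule ℂ H} {S : Circ → H' →L[ℂ] H'} {P : Submodule ℂ H'}
    (h : IsRigidPair R N S P)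
    (hRS : F ⁻¹' (shiftSpan R) = G ⁻¹' (closedSpan (opImage S (hardyMinus H'))))
    {w : H} (hw : w ∈ N) (hw1 : ‖w‖ = 1) :
    ∃ φ V, (∀ᵐ t ∂circMeasure, F φ t = R t w) ∧ IsScalingFunction φ V ∧
      RepresentsSpace F G R S (V 0) ∧ RepresentsFunction F R φ ∧
      ∀ φ' V', IsScalingFunction φ' V' → RepresentsFunction F R φ' →
        V' = V ∧ ∃ c : ℂ, ‖c‖ = 1 ∧ φ' = c • φ := by
  obtain ⟨ρ, hρ, hρ1⟩ := h.rigid_left.exists_column u hw hw1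
  have hR := h.rigid_left.apply_eq h.one_dim hw hw1
  obtain ⟨φ, rfl⟩ := F.surjective ρ
  have hV0 : (levels G S 0 : Set L2R) = G ⁻¹' (closedSpan (opImage S (hardyMinus H'))) := by
    ext f
    rw [SetLike.mem_coe, mem_levels, neg_zero, shift_zero]
    rfl
  have hbasis : IsTranslateBasis φ (levels G S 0) := by
    refine ⟨(orthonormal_translates_iff hF φ).2 hρ1, SetLike.coe_injective ?_⟩
    rw [closedSpan_translates hF, hV0, ← hRS, shiftSpan_eq hR hρ]
  have hsc : IsScalingFunction φ (levels G S) :=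
    ⟨isMRA_levels v hG h.rigid_right.1 h.unitary_ae ⟨φ, hbasis⟩, hbasis⟩
  have hfun : RepresentsFunction F R φ := by
    rw [RepresentsFunction, closedSpan_opImage_constants hR hρ, closedSpan_singleton_preimage F]
  refine ⟨φ, levels G S, hρ, hsc, ⟨hV0.trans hRS.symm, hV0⟩, hfun, fun φ' V' h' hf' => ?_⟩
  exact hsc.unique h' (SetLike.coe_injective (hf'.trans hfun.symm))

/-- The closed span of the `ω^k R 𝔠` consists of the functions with values in the lines
`⟨R(ω)w⟩`. -/
theorem exists_rangeFunction [CompleteSpace H] (u : HilbertBasis ι ℂ H) {R : Circ → H →L[ℂ] H}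
    {N : Submodule ℂ H} (hR : IsRigidOn R N) (hN : Module.finrank ℂ N = 1) :
    ∃ K : Circ → ClosedSubmodule ℂ H, IsMeasurableRange K ∧
      (∀ᵐ t ∂circMeasure, Module.finrank ℂ (K t).toSubmodule = 1) ∧
      rangeSpace K = shiftSpan R := by
  obtain ⟨w, hw, hw1⟩ := exists_unit_of_finrank hN
  obtain ⟨ρ, hρ, hρ1⟩ := hR.exists_column u hw hw1
  refine ⟨fun t => lineThrough (ρ t), isMeasurableRange_lineThrough ρ, ?_, ?_⟩
  · filter_upwards [hρ1] with t ht
    refine finrank_span_singleton fun h0 => ?_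
    simp [h0] at ht
  · rw [rangeSpace_lineThrough hρ1, shiftSpan_eq (hR.apply_eq hN hw hw1) hρ]

end Correspondence

end

end SpectralMRA

theorem theorem4 {I J : Type*} [Countable I] [Countable J]
    (L : HilbertBasis I ℂ (L2On (Set.Ico 0 1)))
    (u : HilbertBasis I ℂ (Ell2 I))
    (Kp : HilbertBasis J ℂ (L2On (Set.Ico 1 2)))
    (Km : HilbertBasis J ℂ (L2On (Set.Ioc (-2) (-1))))
    (v : HilbertBasis (J ⊕ J) ℂ (Ell2Sum J)) :
    -- every scaling function comes from a pair, unique up to constant partial isometries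
    (∀ (V : ℤ → Submodule ℂ L2R) (φ : L2R),
      IsScalingFunction φ V →
      (∃ R N S P, IsRigidPair R N S P ∧
        RepresentsSpace (modelF L u) (modelG Kp Km v)
          R S (V 0) ∧
        RepresentsFunction (modelF L u) R φ) ∧
      (∀ R N S P R' N' S' P',
        IsRigidPair R N S P →
        RepresentsSpace (modelF L u) (modelG Kp Km v)
          R S (V 0) →
        RepresentsFunction (modelF L u) R φ →
        IsRigidPair R' N' S' P' →
        RepresentsSpace (modelF L u) (modelG Kp Km v)
          R' S' (V 0) →
        RepresentsFunction (modelF L u) R' φ →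
        (∃ U, IsPartialIsometryOn U N' ∧ U.range = N ∧
          ∀ᵐ t ∂circMeasure, R' t = R t ∘L U) ∧
        (∃ U, IsPartialIsometryOn U P' ∧ U.range = P ∧
          ∀ᵐ t ∂circMeasure, S' t = S t ∘L U))) ∧
    -- every such pair determines a scaling function, unique up to a unimodular constant
    (∀ R N S P, IsRigidPair R N S P →
      modelF L u ⁻¹' (shiftSpan R) =
        modelG Kp Km v ⁻¹'
          (closedSpan (opImage S
            (hardyMinus (Ell2Sum J)))) →
      ∀ w ∈ N, ‖w‖ = 1 →
        ∃ φ V, (∀ᵐ t ∂circMeasure, modelF L u φ t = R t w) ∧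
          IsScalingFunction φ V ∧
          RepresentsSpace (modelF L u) (modelG Kp Km v)
            R S (V 0) ∧
          RepresentsFunction (modelF L u) R φ ∧
          ∀ φ' V', IsScalingFunction φ' V' →
            RepresentsFunction (modelF L u) R φ' →
            V' = V ∧ ∃ c : ℂ, ‖c‖ = 1 ∧ φ' = c • φ) ∧
    -- the one-dimensional range function
    (∀ V φ R N S P, IsScalingFunction φ V → IsRigidPair R N S P →
      RepresentsSpace (modelF L u) (modelG Kp Km v)
        R S (V 0) →
      RepresentsFunction (modelF L u) R φ →
      ∃ K : Circ → ClosedSubmodule ℂ (Ell2 I),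
        IsMeasurableRange K ∧
        (∀ᵐ t ∂circMeasure, Module.finrank ℂ (K t).toSubmodule = 1) ∧
        modelF L u ⁻¹' (rangeSpace K) =
          modelF L u ⁻¹' (shiftSpan R) ∧
        modelF L u ⁻¹' (rangeSpace K) = (V 0 : Set L2R)) := by
  have hF := modelF_T_zpow L u
  have hG := modelG_D_zpow Kp Km v
  refine ⟨fun V φ hφ => ⟨exists_rigidPair v hF hG hφ, ?_⟩, ?_, ?_⟩
  · intro R N S P R' N' S' P' h hs hf h' hs' hf'
    exact rigidPair_unique u v h hs hf h' hs' hf'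
  · intro R N S P h hRS w hw hw1
    exact exists_scalingFunction u v hF hG h hRS hw hw1
  · intro V φ R N S P _ h hs _
    obtain ⟨K, hK1, hK2, hK3⟩ := exists_rangeFunction u h.rigid_left h.one_dim
    exact ⟨K, hK1, hK2, by rw [hK3], by rw [hK3, hs.1]⟩
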